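/- All graphs are simple and undirected, possibly infinite unless stated otherwise, and are considered up to isomorphism. $\mathcal G\mathit{raphs}$ is the class of all finite graphs and $K_\omega$ is the countably infinite clique. Fix a non-principal ultrafilter $\mathcal U$ on $\mathbb N$. **Class limit.** The ultraproduct $\prod_{\mathcal U}G_n$ of a sequence of graphs has vertex set $\prod_n V(G_n)/\!\sim_{\mathcal U}$, where $a\sim_{\mathcal U}b$ iff $\{n: a_n=b_n\}\in\mathcal U$, and $[a],[b]$ are adjacent iff $\{n: a_nb_n\in E(G_n)\}\in\mathcal U$. For a class $\mathcal C$ of finite graphs, $\mathcal C^\star$ is the class of all (not necessarily induced) subgraphs of ultraproducts of sequences of graphs from $\mathcal C$. $\mathcal C$ is *hereditary* if it is closed under taking induced subgraphs. **Shallow minors.** Let $d\in\mathbb N$. $H$ is a *shallow minor of $G$ at depth $d$* if one can assign to the vertices of $H$ pairwise vertex-disjoint connected subgraphs of $G$ of radius at most $d$ such that, for each edge $uv$ of $H$, some edge of $G$ joins the subgraphs assigned to $u$ and $v$. $H$ is a *topological shallow minor of $G$ at depth $d$* if one can map the vertices of $H$ injectively to vertices of $G$, and each edge $uv$ of $H$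 to a path of $G$ of length at most $2d+1$ between the images of $u$ and $v$, such that no path contains the image of a vertex of $H$ other than its two ends, and the paths of distinct edges have no common vertices other than common endpoints. $\mathcal D\triangledown d$ and $\mathcal D\tilde\triangledown d$ denote the classes of all shallow minors, respectively topological shallow minors, at depth $d$ of graphs from $\mathcal D$. $\mathcal C$ is *nowhere dense* (*topologically nowhere dense*) if there is no $d\in\mathbb N$ with $\mathcal G\mathit{raphs}\subseteq\mathcal C\triangledown d$ (resp. $\mathcal G\mathit{raphs}\subseteq\mathcal C\tilde\triangledown d$). It is *limit nowhere dense* (*limit topologically nowhere dense*) if there is no $d\in\mathbb N$ with $K_\omega\in\mathcal C^\star\triangledown d$ (resp. $K_\omega\in\mathcal C^\star\tilde\triangledown d$). **Quasi-wideness.** A set $X$ of vertices of a graph is *$d$-scattered* if distinct elements of $X$ are at distance larger than $2d$ (possibly infinite). Let $s:\mathbb N\to\mathbb N$. * $\mathcal C$ is *quasi-wide with margin $s$* if for all $d,m\in\mathbb N$ there is $N\in\mathbb N$ such that for each $G\in\mathcal C$ with $|V(G)|\ge N$ there is $S\subseteq V(G)$ with $|S|\le s(d)$ such that $G-S$ contains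 a $d$-scattered set of size $m$. * $\mathcal C$ is *uniformly quasi-wide with margin $s$* if for all $d,m\in\mathbb N$ there is $N\in\mathbb N$ such that for each $G\in\mathcal C$ and each $W\subseteq V(G)$ with $|W|\ge N$ there is $S\subseteq V(G)$ with $|S|\le s(d)$ such that some subset of $W$ of size $m$ is a $d$-scattered set of $G-S$. * $\mathcal C$ is *limit quasi-wide* if for each $d\in\mathbb N$ and each infinite $G\in\mathcal C^\star$ there is a finite $S\subseteq V(G)$ such that $G-S$ contains an infinite $d$-scattered set. * $\mathcal C$ is *uniformly limit quasi-wide* if for each $d\in\mathbb N$, each $G\in\mathcal C^\star$ and each infinite $W\subseteq V(G)$ there is a finite $S\subseteq V(G)$ such that $G-S$ contains an infinite $d$-scattered set included in $W$. * $\mathcal C$ is *strongly limit quasi-wide* (*strongly uniformly limit quasi-wide*) *with margin $s$* if the respective one of the last two conditions holds with "finite $S$" replaced by "$S$ with $|S|\le s(d)$". **Splitter game.** In the $(\ell,m,d)$-splitter game on $G$ the arena is initially $G_0=G$. In round $i+1$, connector picks a vertex $v$ of the arena $G_i$, then splitter picks $W\subseteq V(G_i)$ with $|W|\le m$, and the new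 arena $G_{i+1}$ is the subgraph of $G_i$ induced by the vertices at distance at most $d$ from $v$ in $G_i$ that are not in $W$. Splitter wins if the arena becomes empty within $\ell$ rounds. In the limit $d$-splitter game, splitter picks arbitrary finite sets $W\subseteq V(G_i)$ and wins if the arena becomes empty after finitely many rounds. $\mathcal C$ is *winning for splitter* if for each $d\in\mathbb N$ there are $\ell,m\in\mathbb N$ such that splitter has a winning strategy in the $(\ell,m,d)$-splitter game on every graph in $\mathcal C$; it is *limit winning for splitter* if for each $d\in\mathbb N$ splitter has a winning strategy in the limit $d$-splitter game on every graph in $\mathcal C^\star$. **Theorem.** Let $\mathcal C$ be a class of finite graphs. The following conditions are equivalent. 1. $\mathcal C$ is nowhere dense. 2. $\mathcal C$ is topologically nowhere dense. 3. $\mathcal C$ is limit nowhere dense. 4. $\mathcal C$ is limit topologically nowhere dense. 5. $\mathcal C$ is strongly limit quasi-wide with some margin $s$. 6. $\mathcal C$ is strongly uniformly limit quasi-wide with some margin $s$. 7. $\mathcal C$ is limit quasi-wide. 8. $\mathcal C$ is uniformly limit quasi-wide. 9. $\mathcal C$ is winning for splitter. 10. $\mathcal C$ is limit winning for splitter. Moreover,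 if $\mathcal C$ is hereditary, then the following conditions are also equivalent to the ones above. 11. $\mathcal C$ is quasi-wide with some margin $s$. 12. $\mathcal C$ is uniformly quasi-wide with some margin $s$. -/

import Mathlib

universe u v

/-- A finite simple graph. A class of finite graphs is a `Set FiniteGraph`. -/
structure FiniteGraph : Type (u + 1) where
  V : Type u
  finite : Finite V
  graph : SimpleGraph V

namespace GraphClass

/-- The class is closed, up to isomorphism, under taking induced subgraphs. -/
def Hereditary (C : Set FiniteGraph.{u}) : Prop :=
  ∀ G ∈ C, ∀ s : Set G.V, ∃ H ∈ C, Nonempty (H.graph ≃g G.graph.induce s)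

/-! ### Ultraproducts and class limits -/

/-- The ultraproduct of a sequence of graphs: two classes of sequences are adjacent iff
representatives are adjacent almost everywhere. -/
def ultraproduct (U : Ultrafilter ℕ) {V : ℕ → Type u} (G : ∀ n, SimpleGraph (V n)) :
    SimpleGraph ((U : Filter ℕ).Product V) where
  Adj x y := Quotient.liftOn₂ x y (fun a b => ∀ᶠ n in (U : Filter ℕ), (G n).Adj (a n) (b n)) (by
    intro a b a' b' ha hb
    have ha' : ∀ᶠ n in (U : Filter ℕ), a n = a' n := ha
    have hb' : ∀ᶠ n in (U : Filter ℕ), b n = b' n := hb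
    refine propext (Filter.eventually_congr ?_)
    filter_upwards [ha', hb'] with n h₁ h₂
    rw [h₁, h₂])
  symm := ⟨by
    intro x y
    induction x, y using Quotient.inductionOn₂ with
    | h a b => exact fun h => h.mono fun n hn => hn.symm⟩
  loopless := ⟨by
    intro x
    induction x using Quotient.inductionOn with
    | h a =>
      intro h
      obtain ⟨n, hn⟩ := Filter.Eventually.exists h
      exact (G n).loopless.irrefl _ hn⟩

/-- `G` belongs (up to isomorphism) to the class limit of `C`: it is a subgraph, not necessarily
induced, of the ultraproduct of a sequence of graphs from `C`. -/
def InLimit (U : Ultrafilter ℕ) (C : Set FiniteGraph.{u}) {V : Type u}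
    (G : SimpleGraph V) : Prop :=
  ∃ F : ℕ → FiniteGraph.{u}, (∀ n, F n ∈ C) ∧ 
    SimpleGraph.IsContained G (ultraproduct U fun n => (F n).graph)

/-! ### Shallow minors and nowhere denseness -/

/-- `H` is a shallow minor of `G` at depth `d`. -/
def IsShallowMinor (d : ℕ) {W : Type v} {V : Type u} (H : SimpleGraph W) (G : SimpleGraph V) :
    Prop :=
  ∃ α : W → G.Subgraph,
    (∀ w, (α w).Connected ∧ (α w).coe.radius ≤ d) ∧
    (∀ u w, u ≠ w → Disjoint (α u).verts (α w).verts) ∧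
    ∀ u w, H.Adj u w → ∃ x ∈ (α u).verts, ∃ y ∈ (α w).verts, G.Adj x y

/-- `H` is a topological shallow minor of `G` at depth `d`: some subdivision of `H` in which each
edge becomes a path of length at most `2 * d + 1` is a subgraph of `G`. The path of an edge is
indexed by both orientations of the edge; nothing relates the two, so either can be used. -/
def IsTopShallowMinor (d : ℕ) {W : Type v} {V : Type u} (H : SimpleGraph W)
    (G : SimpleGraph V) : Prop :=
  ∃ (α : W → V) (P : ∀ u w, H.Adj u w → G.Walk (α u) (α w)),
    Function.Injective α ∧
    (∀ u w (h : H.Adj u w), (P u w h).IsPath ∧ (P u w h).length ≤ 2 * d + 1) ∧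
    -- a path meets no branch vertices other than its endpoints
    (∀ u w (h : H.Adj u w) (z : W), α z ∈ (P u w h).support → z = u ∨ z = w) ∧
    -- the paths of distinct edges share at most common endpoints
    ∀ u w (h : H.Adj u w) u' w' (h' : H.Adj u' w'), s(u, w) ≠ s(u', w') →
      ∀ x ∈ (P u w h).support, x ∈ (P u' w' h').support →
        (x = α u ∨ x = α w) ∧ (x = α u' ∨ x = α w')

def SomewhereDense (C : Set FiniteGraph.{u}) : Prop :=
  ∃ d : ℕ, ∀ H : FiniteGraph.{u}, ∃ G ∈ C, IsShallowMinor d H.graph G.graph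

def NowhereDense (C : Set FiniteGraph.{u}) : Prop := ¬ SomewhereDense C

def TopSomewhereDense (C : Set FiniteGraph.{u}) : Prop :=
  ∃ d : ℕ, ∀ H : FiniteGraph.{u}, ∃ G ∈ C, IsTopShallowMinor d H.graph G.graph

def TopNowhereDense (C : Set FiniteGraph.{u}) : Prop := ¬ TopSomewhereDense C

/-- The countably infinite clique is a shallow minor, at some finite depth, of a graph in the
class limit. -/
def LimitSomewhereDense (U : Ultrafilter ℕ) (C : Set FiniteGraph.{u}) : Prop :=
  ∃ (d : ℕ) (V : Type u) (G : SimpleGraph V),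
    InLimit U C G ∧ IsShallowMinor d (SimpleGraph.completeGraph ℕ) G

def LimitNowhereDense (U : Ultrafilter ℕ) (C : Set FiniteGraph.{u}) : Prop :=
  ¬ LimitSomewhereDense U C

def LimitTopSomewhereDense (U : Ultrafilter ℕ) (C : Set FiniteGraph.{u}) : Prop :=
  ∃ (d : ℕ) (V : Type u) (G : SimpleGraph V),
    InLimit U C G ∧ IsTopShallowMinor d (SimpleGraph.completeGraph ℕ) G

def LimitTopNowhereDense (U : Ultrafilter ℕ) (C : Set FiniteGraph.{u}) : Prop :=
  ¬ LimitTopSomewhereDense U C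

/-! ### Quasi-wideness -/

/-- `X` is a set of vertices of `G - S` that is `d`-scattered in `G - S`: distinct vertices of `X`
are at distance (possibly infinite) larger than `2 * d` in `G - S`. -/
def IsScatteredIn {V : Type u} (G : SimpleGraph V) (S : Set V) (d : ℕ)
    (X : Set (Sᶜ : Set V)) : Prop :=
  X.Pairwise fun x y => ((2 * d : ℕ) : ℕ∞) < (G.induce Sᶜ).edist x y

def QuasiWide (C : Set FiniteGraph.{u}) (s : ℕ → ℕ) : Prop :=
  ∀ d m : ℕ, ∃ N : ℕ, ∀ G ∈ C, N ≤ Nat.card G.V →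
    ∃ S : Set G.V, S.encard ≤ s d ∧
      ∃ X : Set (Sᶜ : Set G.V), IsScatteredIn G.graph S d X ∧ X.encard = m

def UniformlyQuasiWide (C : Set FiniteGraph.{u}) (s : ℕ → ℕ) : Prop :=
  ∀ d m : ℕ, ∃ N : ℕ, ∀ G ∈ C, ∀ W : Set G.V, (N : ℕ∞) ≤ W.encard →
    ∃ S : Set G.V, S.encard ≤ s d ∧
      ∃ X : Set (Sᶜ : Set G.V), IsScatteredIn G.graph S d X ∧ X.encard = m ∧
        ∀ x ∈ X, (x : G.V) ∈ W

def LimitQuasiWide (U : Ultrafilter ℕ) (C : Set FiniteGraph.{u}) : Prop :=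
  ∀ (d : ℕ) (V : Type u) (G : SimpleGraph V), InLimit U C G → Infinite V →
    ∃ S : Set V, S.Finite ∧
      ∃ X : Set (Sᶜ : Set V), IsScatteredIn G S d X ∧ X.Infinite

def UniformlyLimitQuasiWide (U : Ultrafilter ℕ) (C : Set FiniteGraph.{u}) : Prop :=
  ∀ (d : ℕ) (V : Type u) (G : SimpleGraph V), InLimit U C G → ∀ W : Set V, W.Infinite →
    ∃ S : Set V, S.Finite ∧
      ∃ X : Set (Sᶜ : Set V), IsScatteredIn G S d X ∧ X.Infinite ∧ ∀ x ∈ X, (x : V) ∈ W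

def StronglyLimitQuasiWide (U : Ultrafilter ℕ) (C : Set FiniteGraph.{u}) (s : ℕ → ℕ) : Prop :=
  ∀ (d : ℕ) (V : Type u) (G : SimpleGraph V), InLimit U C G → Infinite V →
    ∃ S : Set V, S.encard ≤ s d ∧
      ∃ X : Set (Sᶜ : Set V), IsScatteredIn G S d X ∧ X.Infinite

def StronglyUniformlyLimitQuasiWide (U : Ultrafilter ℕ) (C : Set FiniteGraph.{u})
    (s : ℕ → ℕ) : Prop :=
  ∀ (d : ℕ) (V : Type u) (G : SimpleGraph V), InLimit U C G → ∀ W : Set V, W.Infinite →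
    ∃ S : Set V, S.encard ≤ s d ∧
      ∃ X : Set (Sᶜ : Set V), IsScatteredIn G S d X ∧ X.Infinite ∧ ∀ x ∈ X, (x : V) ∈ W

/-! ### The splitter game -/

/-- The (vertex set of the) arena after the rounds listed in the history, most recent round first.
A round `(v, W)` consists of connector's vertex `v` and splitter's finite set `W`; it leaves the
vertices at distance at most `d` from `v` inside the arena, except those in `W`. -/
def arena {V : Type u} (G : SimpleGraph V) (d : ℕ) : List (V × Finset V) → Set V
  | [] => Set.univ
  | (v, W) :: h =>
      {x | x ∉ W ∧ ∃ (hv : v ∈ arena G d h) (hx : x ∈ arena G d h),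
        (G.induce (arena G d h)).edist ⟨v, hv⟩ ⟨x, hx⟩ ≤ d}

/-- The history after the given number of rounds if splitter follows the strategy `τ` and
connector plays `c 0, c 1, …`. -/
def history {V : Type u} (τ : List (V × Finset V) → V → Finset V) (c : ℕ → V) :
    ℕ → List (V × Finset V)
  | 0 => []
  | i + 1 => (c i, τ (history τ c i) (c i)) :: history τ c i

/-- Splitter has a winning strategy in the `(ℓ, m, d)`-splitter game on `G`. A strategy maps the
history and connector's new move to a subset of the arena of size at most `m`; it wins if the arena
becomes empty within `ℓ` rounds whenever connector always moves inside a nonempty arena. -/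
def SplitterWins {V : Type u} (G : SimpleGraph V) (ℓ m d : ℕ) : Prop :=
  ∃ τ : List (V × Finset V) → V → Finset V,
    (∀ h v, (∀ w ∈ τ h v, w ∈ arena G d h) ∧ (τ h v).card ≤ m) ∧
    ∀ c : ℕ → V,
      (∀ i < ℓ, (arena G d (history τ c i)).Nonempty → c i ∈ arena G d (history τ c i)) →
      ∃ i ≤ ℓ, arena G d (history τ c i) = ∅

/-- Splitter has a winning strategy in the limit `d`-splitter game on `G`. -/
def SplitterWinsLimit {V : Type u} (G : SimpleGraph V) (d : ℕ) : Prop :=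
  ∃ τ : List (V × Finset V) → V → Finset V,
    (∀ h v, ∀ w ∈ τ h v, w ∈ arena G d h) ∧
    ∀ c : ℕ → V,
      (∀ i, (arena G d (history τ c i)).Nonempty → c i ∈ arena G d (history τ c i)) →
      ∃ i, arena G d (history τ c i) = ∅

def WinningForSplitter (C : Set FiniteGraph.{u}) : Prop :=
  ∀ d : ℕ, ∃ ℓ m : ℕ, ∀ G ∈ C, SplitterWins G.graph ℓ m d

def LimitWinningForSplitter (U : Ultrafilter ℕ) (C : Set FiniteGraph.{u}) : Prop :=
  ∀ (d : ℕ) (V : Type u) (G : SimpleGraph V), InLimit U C G → SplitterWinsLimit G d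

end GraphClass

/-! The four density conditions form a cycle. If `C` has every finite clique as a shallow minor at
one depth, an ultraproduct of witnesses has an infinite one, since constantly many conditions on
bounded-length walks pass to the ultraproduct (`near_ultraproduct`). An infinite shallow clique can
be thinned out to a subdivided one: inside each branch set infinitely many attachment vertices are
reached by a fan from one vertex, and every pair of branch vertices is routed through a branch set
of its own (`IsShallowMinor.isTopShallowMinor_nat`). Finite parts of a subdivided clique descend
from the limit to members of `C`, and subdivided cliques contract to clique minors.

Quasi-wideness comes from raising the radius of a scattered sequence one step at a time
(`exists_scattered_subseq`). The balls around its terms are disjoint and, by Ramsey's theorem, may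
be taken pairwise nonadjacent. Fewer than `t` vertices can touch infinitely many common balls, where
`t` is the size of a clique excluded as a topological minor; a maximal such set is deleted. If
infinitely many pairwise close balls were left, they would be joined by vertices each touching
finitely many balls, which yields an infinite clique minor. As `t` depends only on the radius and
`C`, so does the margin, and compactness transfers uniform quasi-wideness to the finite graphs.

Splitter wins by deleting short walks from all of connector's earlier vertices to the new one. A
long play would give many vertices, of which no small set can scatter many, because consecutive
pairs have disjoint links.

Conversely, in a clique subdivided with short paths, after the deletion of a few vertices the
surviving branch vertices are still close to each other (`IsSubdivision.near_of_notMem`). Hence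
connector can play branch vertices as long as needed, and the subdivision has no large scattered
set. -/

namespace GraphClass

/-! ### Bounded distance inside a set of vertices -/

/-- There is a walk of length at most `k` from `x` to `y` all of whose vertices lie in `T`. -/
def Near {V : Type u} (G : SimpleGraph V) (T : Set V) (k : ℕ) (x y : V) : Prop :=
  ∃ p : G.Walk x y, p.length ≤ k ∧ ∀ v ∈ p.support, v ∈ T

namespace Near

variable {V : Type u} {G : SimpleGraph V} {T T' : Set V} {k l : ℕ} {x y z : V}

theorem refl (hx : x ∈ T) (k : ℕ) : Near G T k x x :=
  ⟨.nil, by simp, by simpa using hx⟩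

theorem symm (h : Near G T k x y) : Near G T k y x := by
  obtain ⟨p, hp, hT⟩ := h
  exact ⟨p.reverse, by simpa using hp, by simpa using hT⟩

theorem trans (h : Near G T k x y) (h' : Near G T l y z) : Near G T (k + l) x z := by
  obtain ⟨p, hp, hT⟩ := h
  obtain ⟨q, hq, hT'⟩ := h'
  refine ⟨p.append q, by rw [SimpleGraph.Walk.length_append]; omega, fun v hv => ?_⟩
  rcases (SimpleGraph.Walk.mem_support_append_iff _ _).1 hv with h | h
  exacts [hT v h, hT' v h]

theorem mono (h : Near G T k x y) (hT : T ⊆ T') (hk : k ≤ l) : Near G T' l x y := by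
  obtain ⟨p, hp, hpT⟩ := h
  exact ⟨p, hp.trans hk, fun v hv => hT (hpT v hv)⟩

theorem left_mem (h : Near G T k x y) : x ∈ T := by
  obtain ⟨p, -, hT⟩ := h
  exact hT _ p.start_mem_support

theorem right_mem (h : Near G T k x y) : y ∈ T := h.symm.left_mem

theorem of_adj (h : G.Adj x y) (hx : x ∈ T) (hy : y ∈ T) : Near G T 1 x y :=
  ⟨h.toWalk, by simp, by simp [hx, hy]⟩

theorem eq_of_zero (h : Near G T 0 x y) : x = y := by
  obtain ⟨p, hp, -⟩ := h
  exact SimpleGraph.Walk.eq_of_length_eq_zero (Nat.le_zero.1 hp)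

theorem succ_iff : Near G T (k + 1) x y ↔
    x ∈ T ∧ (x = y ∨ ∃ z, G.Adj x z ∧ Near G T k z y) := by
  constructor
  · rintro ⟨p, hp, hT⟩
    refine ⟨hT _ p.start_mem_support, ?_⟩
    cases p with
    | nil => exact .inl rfl
    | cons h q =>
      refine .inr ⟨_, h, q, by simpa using hp, fun v hv => hT v ?_⟩
      simp [hv]
  · rintro ⟨hx, rfl | ⟨z, hz, h⟩⟩
    · exact refl hx _
    · exact ((of_adj hz hx h.left_mem).trans h).mono subset_rfl (by omega)

theorem split (h : Near G T (k + l) x y) : ∃ z, Near G T k x z ∧ Near G T l z y := by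
  induction k generalizing x with
  | zero => exact ⟨x, refl h.left_mem _, by simpa using h⟩
  | succ k ih =>
    rw [show k + 1 + l = k + l + 1 by omega, succ_iff] at h
    obtain ⟨hx, rfl | ⟨w, hw, h⟩⟩ := h
    · exact ⟨x, refl hx _, refl hx _⟩
    · obtain ⟨z, hz, h'⟩ := ih h
      exact ⟨z, succ_iff.2 ⟨hx, .inr ⟨w, hw, hz⟩⟩, h'⟩

theorem eq_or_adj (h : Near G T 1 x y) : x = y ∨ G.Adj x y := by
  obtain ⟨-, h | ⟨z, hz, h⟩⟩ := succ_iff.1 h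
  exacts [.inl h, .inr (h.eq_of_zero ▸ hz)]

/-- A walk witnessing `Near` stays among the vertices that are near its starting point. -/
theorem within (h : Near G T k x y) : Near G {z | Near G T k x z} k x y := by
  classical
  obtain ⟨p, hp, hT⟩ := h
  refine ⟨p, hp, fun v hv => ⟨p.takeUntil v hv, (p.length_takeUntil_le_length hv).trans hp, ?_⟩⟩
  exact fun w hw => hT w (p.support_takeUntil_subset_support hv hw)

theorem of_walk_map {V' : Type*} {G' : SimpleGraph V'} {a b : V'} (f : G' →g G)
    (p : G'.Walk a b) (hp : p.length ≤ k) (hf : ∀ v, f v ∈ T) : Near G T k (f a) (f b) := by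
  refine ⟨p.map f, by simpa using hp, fun v hv => ?_⟩
  rw [SimpleGraph.Walk.support_map, List.mem_map] at hv
  obtain ⟨w, -, rfl⟩ := hv
  exact hf w

end Near

section

variable {V : Type u} {G : SimpleGraph V}

theorem edist_le_iff {k : ℕ} {x y : V} :
    G.edist x y ≤ k ↔ ∃ p : G.Walk x y, p.length ≤ k := by
  constructor
  · intro h
    obtain ⟨p, hp⟩ := SimpleGraph.exists_walk_of_edist_ne_top (G := G) (u := x) (v := y)
      (ne_top_of_le_ne_top (ENat.natCast_ne_top k) h)
    exact ⟨p, by rw [← hp] at h; exact_mod_cast h⟩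
  · rintro ⟨p, hp⟩
    exact (SimpleGraph.edist_le p).trans (by exact_mod_cast hp)

/-- Arenas and scattered sets are both defined by distances in induced subgraphs; this turns them
into walks of `G` confined to a set, so that walks in different arenas can be compared and
concatenated without subtypes. -/
theorem edist_induce_le_iff {T : Set V} {k : ℕ} {x y : V} (hx : x ∈ T) (hy : y ∈ T) :
    (G.induce T).edist ⟨x, hx⟩ ⟨y, hy⟩ ≤ k ↔ Near G T k x y := by
  rw [edist_le_iff]
  constructor
  · rintro ⟨p, hp⟩
    exact Near.of_walk_map (SimpleGraph.Embedding.induce T).toHom p hp fun v => v.2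
  · rintro ⟨p, hp, hT⟩
    refine ⟨p.induce T hT, ?_⟩
    have := congrArg SimpleGraph.Walk.length (SimpleGraph.Walk.map_induce p hT)
    exact ((SimpleGraph.Walk.length_map _ _).symm.trans this).trans_le hp

theorem isScatteredIn_iff {S : Set V} {d : ℕ} {X : Set (Sᶜ : Set V)} :
    IsScatteredIn G S d X ↔ ∀ x ∈ X, ∀ y ∈ X, x ≠ y → ¬ Near G Sᶜ (2 * d) x y := by
  unfold IsScatteredIn Set.Pairwise
  refine forall₂_congr fun x _ => forall₂_congr fun y _ => forall_congr' fun _ => ?_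
  rw [← edist_induce_le_iff x.2 y.2, not_le]

/-! ### Shallow minors -/

/-- To exhibit a shallow minor it suffices to give disjoint sets of vertices with centers, such
that each edge is realized by an edge whose ends are near the centers. -/
theorem isShallowMinor_of_near {W : Type v} {H : SimpleGraph W} {d : ℕ} (c : W → V)
    (T : W → Set V) (hc : ∀ w, c w ∈ T w) (hT : ∀ u w, u ≠ w → Disjoint (T u) (T w))
    (hE : ∀ u w, H.Adj u w → ∃ x y, Near G (T u) d (c u) x ∧ Near G (T w) d (c w) y ∧
      G.Adj x y) : IsShallowMinor d H G := by
  -- The branch sets are the balls of radius `d` inside `T w`, which makes connectedness and the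
  -- radius bound automatic.
  set A : W → Set V := fun w => {x | Near G (T w) d (c w) x} with hA
  have hAT : ∀ w, A w ⊆ T w := fun w x hx => Near.right_mem hx
  have hcA : ∀ w, c w ∈ A w := fun w => Near.refl (hc w) d
  have hnear : ∀ w (x : A w), (G.induce (A w)).edist ⟨c w, hcA w⟩ x ≤ d := fun w x =>
    (edist_induce_le_iff (hcA w) x.2).2 (Near.within x.2)
  refine ⟨fun w => (⊤ : G.Subgraph).induce (A w), fun w => ⟨?_, ?_⟩, fun u w huw => ?_, ?_⟩
  · rw [← SimpleGraph.connected_induce_iff]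
    refine SimpleGraph.connected_iff_exists_forall_reachable _ |>.2 ⟨⟨c w, hcA w⟩, fun x => ?_⟩
    exact SimpleGraph.reachable_of_edist_ne_top
      (ne_top_of_le_ne_top (ENat.natCast_ne_top d) (hnear w x))
  · have hco : ((⊤ : G.Subgraph).induce (A w)).coe = G.induce (A w) := by
      ext x y
      have hx : (x : V) ∈ A w := x.2
      have hy : (y : V) ∈ A w := y.2
      simp only [SimpleGraph.Subgraph.coe_adj, SimpleGraph.Subgraph.induce_adj,
        SimpleGraph.Subgraph.top_adj, hx, hy, true_and]
      rfl
    rw [hco]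
    exact SimpleGraph.radius_le_eccent.trans ((SimpleGraph.eccent_le_iff _ _).2 (hnear w))
  · exact (hT u w huw).mono (hAT u) (hAT w)
  · intro u w h
    obtain ⟨x, y, hx, hy, hxy⟩ := hE u w h
    exact ⟨x, hx, y, hy, hxy⟩

/-- The radius of a branch set is attained at one of its vertices, which serves as the center. -/
theorem IsShallowMinor.exists_near {W : Type v} {H : SimpleGraph W} {d : ℕ}
    (h : IsShallowMinor d H G) : ∃ (c : W → V) (T : W → Set V), (∀ w, c w ∈ T w) ∧
      (∀ u w, u ≠ w → Disjoint (T u) (T w)) ∧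
      ∀ u w, H.Adj u w → ∃ x y, Near G (T u) d (c u) x ∧ Near G (T w) d (c w) y ∧
        G.Adj x y := by
  obtain ⟨α, hα, hdisj, hE⟩ := h
  have hc : ∀ w, ∃ c ∈ (α w).verts, ∀ x ∈ (α w).verts, Near G (α w).verts d c x := by
    intro w
    have := (hα w).1.coe.nonempty
    obtain ⟨c, hc⟩ := (α w).coe.exists_eccent_eq_radius
    refine ⟨c, c.2, fun x hx => ?_⟩
    have h1 := ((SimpleGraph.eccent_le_iff _ _).1 (hc.trans_le (hα w).2)) ⟨x, hx⟩
    obtain ⟨p, hp⟩ := edist_le_iff.1 h1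
    exact Near.of_walk_map (α w).hom p hp fun v => v.2
  choose c hc hnear using hc
  refine ⟨c, fun w => (α w).verts, hc, hdisj, fun u w h => ?_⟩
  obtain ⟨x, hx, y, hy, hxy⟩ := hE u w h
  exact ⟨x, y, hnear u x hx, hnear w y hy, hxy⟩

theorem IsShallowMinor.mono_left {W : Type*} {W' : Type v} {H : SimpleGraph W}
    {H' : SimpleGraph W'} {d : ℕ} (h : IsShallowMinor d H G) (f : SimpleGraph.Copy H' H) :
    IsShallowMinor d H' G := by
  obtain ⟨α, hα, hdisj, hE⟩ := h
  exact ⟨fun w => α (f w), fun w => hα _, fun u w huw => hdisj _ _ (f.injective.ne huw),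
    fun u w huw => hE _ _ (f.toHom.map_adj huw)⟩

/-! ### Topological shallow minors -/

/-- The map `α` and the paths `P` form a subdivision of `H` in `G` whose paths have length at
most `2 * d + 1`. -/
structure IsSubdivision {V : Type u} {W : Type v} (d : ℕ) (H : SimpleGraph W) (G : SimpleGraph V)
    (α : W → V) (P : ∀ u w, H.Adj u w → G.Walk (α u) (α w)) : Prop where
  injective : Function.Injective α
  path : ∀ u w (h : H.Adj u w), (P u w h).IsPath ∧ (P u w h).length ≤ 2 * d + 1
  branch : ∀ u w (h : H.Adj u w) (z : W), α z ∈ (P u w h).support → z = u ∨ z = w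
  inter : ∀ u w (h : H.Adj u w) u' w' (h' : H.Adj u' w'), s(u, w) ≠ s(u', w') →
    ∀ x ∈ (P u w h).support, x ∈ (P u' w' h').support →
      (x = α u ∨ x = α w) ∧ (x = α u' ∨ x = α w')

theorem isTopShallowMinor_iff {W : Type v} {H : SimpleGraph W} {d : ℕ} :
    IsTopShallowMinor d H G ↔ ∃ α P, IsSubdivision d H G α P := by
  constructor
  · rintro ⟨α, P, hα, hP, hb, hdisj⟩
    exact ⟨α, P, hα, hP, hb, hdisj⟩
  · rintro ⟨α, P, hα, hP, hb, hdisj⟩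
    exact ⟨α, P, hα, hP, hb, hdisj⟩

theorem IsTopShallowMinor.mono_left {W : Type*} {W' : Type v} {H : SimpleGraph W}
    {H' : SimpleGraph W'} {d : ℕ} (h : IsTopShallowMinor d H G) (f : SimpleGraph.Copy H' H) :
    IsTopShallowMinor d H' G := by
  obtain ⟨α, P, hα, hP, hb, hdisj⟩ := h
  refine ⟨fun w => α (f w), fun u w h => P _ _ (f.toHom.map_adj h), hα.comp f.injective,
    fun u w h => hP _ _ _, fun u w h z hz => ?_, fun u w h u' w' h' hne x hx hx' => ?_⟩
  · exact (hb _ _ _ _ hz).imp (fun h => f.injective h) (fun h => f.injective h)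
  · refine hdisj _ _ _ _ _ _ (fun he => hne ?_) x hx hx'
    exact Sym2.map.injective f.injective (by simpa using he)

theorem IsSubdivision.map {W : Type v} {V' : Type*} {H : SimpleGraph W}
    {G' : SimpleGraph V'} {d : ℕ} {α : W → V} {P : ∀ u w, H.Adj u w → G.Walk (α u) (α w)}
    (hs : IsSubdivision d H G α P) (f : G →g G') (hf : Function.Injective f) :
    IsSubdivision d H G' (fun w => f (α w)) (fun u w h => (P u w h).map f) := by
  refine ⟨hf.comp hs.injective, fun u w h => ⟨(hs.path u w h).1.map hf,
      by simpa using (hs.path u w h).2⟩, fun u w h z hz => ?_,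
    fun u w h u' w' h' hne x hx hx' => ?_⟩
  · rw [SimpleGraph.Walk.support_map, List.mem_map] at hz
    obtain ⟨y, hy, hyz⟩ := hz
    exact hs.branch u w h z (hf hyz ▸ hy)
  · rw [SimpleGraph.Walk.support_map, List.mem_map] at hx hx'
    obtain ⟨y, hy, rfl⟩ := hx
    obtain ⟨y', hy', hyy⟩ := hx'
    obtain rfl : y' = y := hf hyy
    have := hs.inter u w h u' w' h' hne y' hy hy'
    exact ⟨this.1.imp (congrArg f) (congrArg f), this.2.imp (congrArg f) (congrArg f)⟩

theorem IsTopShallowMinor.mono_right {W : Type v} {V' : Type*} {H : SimpleGraph W}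
    {G' : SimpleGraph V'} {d : ℕ} (h : IsTopShallowMinor d H G) (f : SimpleGraph.Copy G G') :
    IsTopShallowMinor d H G' := by
  obtain ⟨α, P, hs⟩ := isTopShallowMinor_iff.1 h
  exact isTopShallowMinor_iff.2 ⟨_, _, hs.map f.toHom f.injective⟩

theorem mem_support_induce {s : Set V} {x y : V} {p : G.Walk x y}
    (hp : ∀ v ∈ p.support, v ∈ s) {z : s} : z ∈ (p.induce s hp).support ↔ (z : V) ∈ p.support := by
  rw [SimpleGraph.Walk.support_induce]
  simp

theorem IsSubdivision.induce {W : Type v} {H : SimpleGraph W} {d : ℕ}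
    {α : W → V} {P : ∀ u w, H.Adj u w → G.Walk (α u) (α w)} (hs : IsSubdivision d H G α P)
    {s : Set V} (hαs : ∀ w, α w ∈ s) (hPs : ∀ u w h, ∀ x ∈ (P u w h).support, x ∈ s) :
    IsSubdivision d H (G.induce s) (fun w => ⟨α w, hαs w⟩)
      (fun u w h => (P u w h).induce s (hPs u w h)) := by
  refine ⟨fun u w h => hs.injective (congrArg Subtype.val h), fun u w h => ⟨?_, ?_⟩,
    fun u w h z hz => hs.branch u w h z ((mem_support_induce _).1 hz),
    fun u w h u' w' h' hne x hx hx' => ?_⟩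
  · have := (hs.path u w h).1
    rw [← SimpleGraph.Walk.map_induce (P u w h) (hPs u w h)] at this
    exact this.of_map
  · have := congrArg SimpleGraph.Walk.length
      (SimpleGraph.Walk.map_induce (P u w h) (hPs u w h))
    rw [SimpleGraph.Walk.length_map] at this
    exact this.trans_le (hs.path u w h).2
  · have := hs.inter u w h u' w' h' hne x ((mem_support_induce _).1 hx)
      ((mem_support_induce _).1 hx')
    simpa [Subtype.ext_iff] using this

/-- A topological shallow minor of a clique arises from linking sets for the pairs of branch
vertices that meet only in common ends. -/
theorem isTopShallowMinor_of_link {ι : Type v} [LinearOrder ι] {d : ℕ} (α : ι → V)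
    (hα : Function.Injective α) (Q : ι → ι → Set V)
    (hQ : ∀ i j, i < j → Near G (Q i j) (2 * d + 1) (α i) (α j))
    (hb : ∀ i j, i < j → ∀ k, α k ∈ Q i j → k = i ∨ k = j)
    (hdisj : ∀ i j i' j', i < j → i' < j' → (i, j) ≠ (i', j') → ∀ x ∈ Q i j, x ∈ Q i' j' →
      (x = α i ∨ x = α j) ∧ (x = α i' ∨ x = α j')) :
    IsTopShallowMinor d (SimpleGraph.completeGraph ι) G := by
  classical
  -- Both orientations of a pair are routed through the linking set of the sorted pair, so
  -- hypotheses about `i < j` suffice.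
  have key : ∀ i j : ι, i ≠ j → ∃ p : G.Walk (α i) (α j), p.IsPath ∧ p.length ≤ 2 * d + 1 ∧
      ∀ x ∈ p.support, x ∈ Q (min i j) (max i j) := by
    intro i j hij
    have hn : Near G (Q (min i j) (max i j)) (2 * d + 1) (α i) (α j) := by
      rcases lt_or_gt_of_ne hij with h | h
      · rw [min_eq_left h.le, max_eq_right h.le]; exact hQ i j h
      · rw [min_eq_right h.le, max_eq_left h.le]; exact (hQ j i h).symm
    obtain ⟨p, hp, hpT⟩ := hn
    exact ⟨p.bypass, p.bypass_isPath, p.length_bypass_le_length.trans hp,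
      fun x hx => hpT x (p.support_bypass_subset_support hx)⟩
  choose P hP hlen hsup using key
  have hmm : ∀ i j : ι, i ≠ j → min i j < max i j := fun i j h => min_lt_max.2 h
  have hor : ∀ (i j : ι) {p : ι → Prop}, p (min i j) ∨ p (max i j) → p i ∨ p j := by
    intro i j p h
    rcases le_total i j with h' | h'
    · simpa [h'] using h
    · simpa [h', or_comm] using h
  refine ⟨α, fun i j h => P i j h.ne, hα, fun i j h => ⟨hP _ _ _, hlen _ _ _⟩,
    fun i j h k hk => ?_, fun i j h i' j' h' hne x hx hx' => ?_⟩
  · exact hor i j (p := fun z => k = z)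
      (hb _ _ (hmm i j h.ne) k (hsup _ _ _ _ hk))
  · have := hdisj _ _ _ _ (hmm i j h.ne) (hmm i' j' h'.ne) (fun he => hne ?_) x
      (hsup _ _ _ _ hx) (hsup _ _ _ _ hx')
    · exact ⟨hor i j (p := fun z => x = α z) this.1, hor i' j' (p := fun z => x = α z) this.2⟩
    · rw [Prod.mk.injEq] at he
      rcases le_total i j with h1 | h1 <;> rcases le_total i' j' with h2 | h2 <;>
        simp only [h1, h2, min_eq_left, max_eq_right, min_eq_right, max_eq_left] at he <;>
        simp [he.1, he.2, Sym2.eq_swap]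

/-- A topological shallow minor of a clique gives a shallow minor. -/
theorem IsTopShallowMinor.isShallowMinor {ι : Type v} [LinearOrder ι] {d : ℕ}
    (h : IsTopShallowMinor d (SimpleGraph.completeGraph ι) G) :
    IsShallowMinor (2 * d + 1) (SimpleGraph.completeGraph ι) G := by
  classical
  obtain ⟨α, P, hα, hP, hb, hdisj⟩ := h
  have hadj : ∀ {i j : ι}, i < j → (SimpleGraph.completeGraph ι).Adj i j := fun h => h.ne
  -- The smaller index owns the whole path except its far end. The last edge of the path then joins
  -- the two branch sets.
  set T : ι → Set V := fun i =>
    {x | x = α i ∨ ∃ j, ∃ h : i < j, x ∈ (P i j (hadj h)).support ∧ x ≠ α j} with hT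
  have hlink : ∀ i j (h : i < j), ∃ x, Near G (T i) (2 * d + 1) (α i) x ∧ G.Adj x (α j) := by
    intro i j h
    have hne : ¬ (P i j (hadj h)).Nil := SimpleGraph.Walk.not_nil_of_ne (hα.ne h.ne)
    refine ⟨(P i j (hadj h)).penultimate, ?_, (P i j (hadj h)).adj_penultimate hne⟩
    refine ⟨(P i j (hadj h)).dropLast, ?_, fun v hv => ?_⟩
    · have := (hP i j (hadj h)).2
      have h2 : (P i j (hadj h)).dropLast.length ≤ (P i j (hadj h)).length := by
        simp [SimpleGraph.Walk.dropLast, SimpleGraph.Walk.take_length]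
      omega
    · refine .inr ⟨j, h, ?_, ?_⟩
      · rw [SimpleGraph.Walk.support_dropLast hne] at hv
        exact List.mem_of_mem_dropLast hv
      · rintro rfl
        have hnd := (hP i j (hadj h)).1.support_nodup
        rw [SimpleGraph.Walk.support_dropLast hne] at hv
        rw [← List.dropLast_append_getLast (SimpleGraph.Walk.support_ne_nil (P i j (hadj h))),
          SimpleGraph.Walk.getLast_support] at hnd
        exact (List.nodup_append.1 hnd).2.2 _ hv _ (by simp) rfl
  have hTlt : ∀ i j, i < j → Disjoint (T i) (T j) := by
    intro i j hij
    rw [Set.disjoint_left]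
    rintro x (rfl | ⟨k, hk, hx, hxk⟩) (h | ⟨l, hl, hx', hxl⟩)
    · exact hij.ne (hα h)
    · rcases hb _ _ _ _ hx' with h | h
      · exact hij.ne h
      · exact (hij.trans hl).ne h
    · rcases hb _ _ _ j (h ▸ hx) with h' | h'
      · exact hij.ne' h'
      · exact hxk (h' ▸ h)
    · have := hdisj _ _ (hadj hk) _ _ (hadj hl) (by
        rw [Ne, Sym2.eq_iff]
        rintro (⟨h, -⟩ | ⟨h, -⟩)
        · exact hij.ne h
        · exact (hij.trans hl).ne h) x hx hx'
      rcases this with ⟨h | h, h' | h'⟩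
      · exact hij.ne (hα (h.symm.trans h'))
      · exact hxl h'
      · exact hxk h
      · exact hxk h
  refine isShallowMinor_of_near α T (fun i => .inl rfl) (fun i j hij => ?_) (fun i j h => ?_)
  · rcases lt_or_gt_of_ne hij with h | h
    exacts [hTlt i j h, (hTlt j i h).symm]
  · rcases lt_or_gt_of_ne h.ne with h | h
    · obtain ⟨x, hx, hxj⟩ := hlink i j h
      exact ⟨x, α j, hx, Near.refl (.inl rfl) _, hxj⟩
    · obtain ⟨x, hx, hxj⟩ := hlink j i h
      exact ⟨α i, x, Near.refl (.inl rfl) _, hx, hxj.symm⟩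

end

/-! ### Diagonal sequences and Ramsey's theorem for pairs -/

/-- If every infinite set can be thinned out to an infinite set that is good for a given number,
then some infinite sequence is such that its tails are good for the preceding terms. -/
theorem exists_diagonal_seq (Good : ℕ → Set ℕ → Prop)
    (mono : ∀ i J J', J' ⊆ J → Good i J → Good i J')
    (ex : ∀ i J, J.Infinite → ∃ J' ⊆ J, J'.Infinite ∧ Good i J') {J : Set ℕ}
    (hJ : J.Infinite) :
    ∃ g : ℕ → ℕ, StrictMono g ∧ (∀ i, g i ∈ J) ∧ ∀ i, Good (g i) {n | ∃ j, i < j ∧ g j = n} := by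
  have step : ∀ A : {A : Set ℕ // A.Infinite}, ∃ (a : ℕ) (B : {A : Set ℕ // A.Infinite}),
      a ∈ A.1 ∧ B.1 ⊆ A.1 ∧ (∀ b ∈ B.1, a < b) ∧ Good a B.1 := by
    rintro ⟨A, hA⟩
    obtain ⟨a, ha⟩ := hA.nonempty
    obtain ⟨B, hBA, hB, hg⟩ := ex a (A \ Set.Iic a) (hA.sdiff (Set.finite_Iic a))
    exact ⟨a, ⟨B, hB⟩, ha, fun b hb => (hBA hb).1, fun b hb => by simpa using (hBA hb).2, hg⟩
  choose a B ha hBA hlt hg using step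
  let A : ℕ → {A : Set ℕ // A.Infinite} := fun n => B^[n] ⟨J, hJ⟩
  have hA : ∀ n, A (n + 1) = B (A n) := fun n => Function.iterate_succ_apply' B n _
  have hanti : Antitone fun n => (A n).1 := antitone_nat_of_succ_le fun n => by
    rw [hA]; exact hBA _
  have hmem : ∀ i j, i < j → a (A j) ∈ (B (A i)).1 := fun i j hij => by
    rw [← hA]; exact hanti hij (ha _)
  refine ⟨fun n => a (A n), fun i j hij => hlt _ _ (hmem i j hij), fun i => ?_, fun i => ?_⟩
  · exact hanti (Nat.zero_le i) (ha (A i))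
  · refine mono _ _ _ ?_ (hg (A i))
    rintro _ ⟨j, hij, rfl⟩
    exact hmem i j hij

/-- The infinite Ramsey theorem for pairs. -/
theorem exists_homogeneous_seq (r : ℕ → ℕ → Prop) : ∃ g : ℕ → ℕ, StrictMono g ∧
    ((∀ i j, i < j → r (g i) (g j)) ∨ ∀ i j, i < j → ¬ r (g i) (g j)) := by
  obtain ⟨g, hg, -, hgood⟩ := exists_diagonal_seq
    (fun i J => (∀ j ∈ J, r i j) ∨ ∀ j ∈ J, ¬ r i j)
    (fun i J J' hJ h => h.imp (fun h j hj => h j (hJ hj)) (fun h j hj => h j (hJ hj)))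
    (fun i J hJ => by
      by_cases h : (J ∩ {j | r i j}).Infinite
      · exact ⟨_, Set.inter_subset_left, h, .inl fun j hj => hj.2⟩
      · refine ⟨J \ (J ∩ {j | r i j}), Set.sdiff_subset, ?_, .inr fun j hj => ?_⟩
        · exact hJ.sdiff (Set.not_infinite.1 h)
        · exact fun hr => hj.2 ⟨hj.1, hr⟩) Set.infinite_univ
  -- Along the diagonal sequence the color of a pair depends only on its smaller index, and one of
  -- the two colors occurs infinitely often.
  by_cases h : {i | ∀ j, i < j → r (g i) (g j)}.Infinite
  · refine ⟨fun n => g (Nat.nth _ n), hg.comp (Nat.nth_strictMono h), .inl fun i j hij => ?_⟩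
    exact Nat.nth_mem_of_infinite h i _ (Nat.nth_strictMono h hij)
  · have h' : {i | ∀ j, i < j → ¬ r (g i) (g j)}.Infinite := by
      refine (Set.not_infinite.1 h).infinite_compl.mono fun i hi => ?_
      rcases hgood i with h1 | h1
      · exact absurd (fun j hij => h1 _ ⟨j, hij, rfl⟩) hi
      · exact fun j hij => h1 _ ⟨j, hij, rfl⟩
    refine ⟨fun n => g (Nat.nth _ n), hg.comp (Nat.nth_strictMono h'), .inr fun i j hij => ?_⟩
    exact Nat.nth_mem_of_infinite h' i _ (Nat.nth_strictMono h' hij)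

/-- An infinite set in which every member conflicts with finitely many others has an infinite
subset without conflicts. -/
theorem exists_infinite_independent {J : Set ℕ} (hJ : J.Infinite) (r : ℕ → ℕ → Prop)
    (hr : ∀ i ∈ J, {j | j ∈ J ∧ r i j}.Finite) :
    ∃ J' ⊆ J, J'.Infinite ∧ ∀ i ∈ J', ∀ j ∈ J', i < j → ¬ r i j := by
  obtain ⟨g, hg, hgJ, hgood⟩ := exists_diagonal_seq
    (fun i J' => i ∈ J → ∀ j ∈ J', j ∈ J → ¬ r i j)
    (fun i J J' hJ h hi j hj => h hi j (hJ hj))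
    (fun i J' hJ' => by
      by_cases hi : i ∈ J
      · refine ⟨J' \ {j | j ∈ J ∧ r i j}, Set.sdiff_subset, hJ'.sdiff (hr i hi), fun _ j hj => ?_⟩
        exact fun hjJ hrij => hj.2 ⟨hjJ, hrij⟩
      · exact ⟨J', subset_rfl, hJ', fun h => absurd h hi⟩) hJ
  refine ⟨Set.range g, Set.range_subset_iff.2 hgJ, Set.infinite_range_of_injective hg.injective,
    ?_⟩
  rintro _ ⟨i, rfl⟩ _ ⟨j, rfl⟩ hij
  exact hgood i (hgJ i) _ ⟨j, hg.lt_iff_lt.1 hij, rfl⟩ (hgJ j)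

/-! ### From shallow minors to topological shallow minors -/

section

variable {V : Type u} {G : SimpleGraph V}

/-- If infinitely many vertices are near `c` in `T`, then some vertex of `T` is joined to
infinitely many of them by short walks in `T` that are disjoint except for their common origin. -/
theorem exists_fan {T : Set V} (y : ℕ → V) (d : ℕ) {c : V} {J : Set ℕ} (hJ : J.Infinite)
    (hy : ∀ j ∈ J, Near G T d c (y j)) :
    ∃ x ∈ T, ∃ J' ⊆ J, J'.Infinite ∧ ∃ Q : ℕ → Set V,
      (∀ j ∈ J', Q j ⊆ T ∧ Near G (Q j) d x (y j)) ∧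
      ∀ i ∈ J', ∀ j ∈ J', i ≠ j → Q i ∩ Q j ⊆ {x} := by
  classical
  induction d generalizing c J with
  | zero =>
    obtain ⟨j₀, hj₀⟩ := hJ.nonempty
    refine ⟨c, (hy _ hj₀).left_mem, J, subset_rfl, hJ, fun _ => {c}, fun j hj => ⟨?_, ?_⟩, ?_⟩
    · simpa using (hy _ hj₀).left_mem
    · rw [← (hy j hj).eq_of_zero]
      exact Near.refl (Set.mem_singleton c) _
    · simp
  | succ d ih =>
    -- Either some vertex reaches infinitely many targets in one step less, and it becomes the new
    -- origin; or every vertex is within `d` of finitely many targets, and `c` itself can be the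
    -- origin: a vertex on a tail `R j` is within `d` of `y j`, so each tail meets only finitely
    -- many others.
    by_cases hx : ∃ x, {j | j ∈ J ∧ Near G T d x (y j)}.Infinite
    · obtain ⟨x, hx⟩ := hx
      obtain ⟨z, hz, J', hJ', hinf, Q, hQ, hQd⟩ := ih hx fun j hj => hj.2
      exact ⟨z, hz, J', fun j hj => (hJ' hj).1, hinf, Q,
        fun j hj => ⟨(hQ j hj).1, (hQ j hj).2.mono subset_rfl (Nat.le_succ d)⟩, hQd⟩
    · simp only [not_exists, Set.not_infinite] at hx
      obtain ⟨j₀, hj₀⟩ := hJ.nonempty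
      have hcT := (hy _ hj₀).left_mem
      -- Discarding the finitely many targets within `d` of `c` ensures that the remaining walks
      -- have a first edge.
      set J₁ := J \ {j | j ∈ J ∧ Near G T d c (y j)} with hJ₁
      have hJ₁inf : J₁.Infinite := hJ.sdiff (hx c)
      have tail : ∀ j, ∃ R : Finset V, j ∈ J₁ → ∃ z, G.Adj c z ∧ (∀ v ∈ R, Near G T d v (y j)) ∧
          Near G (R : Set V) d z (y j) := by
        intro j
        by_cases hj : j ∈ J₁
        · obtain ⟨-, h | ⟨z, hz, p, hp, hpT⟩⟩ := Near.succ_iff.1 (hy j hj.1)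
          · exact absurd ⟨hj.1, h ▸ Near.refl hcT d⟩ hj.2
          · refine ⟨p.support.toFinset, fun _ => ⟨z, hz, fun v hv => ?_, p, hp, by simp⟩⟩
            rw [List.mem_toFinset] at hv
            exact ⟨p.dropUntil v hv, (p.length_dropUntil_le_length hv).trans hp,
              fun w hw => hpT w (p.support_dropUntil_subset_support hv hw)⟩
        · exact ⟨∅, fun h => absurd h hj⟩
      choose R hR using tail
      obtain ⟨J', hJ', hinf, hind⟩ := exists_infinite_independent hJ₁inf
        (fun i j => ¬ Disjoint (R i) (R j)) (fun i hi => by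
          refine (Set.Finite.biUnion (R i).finite_toSet fun v _ => hx v).subset ?_
          rintro j ⟨hj, hd⟩
          rw [Finset.not_disjoint_iff] at hd
          obtain ⟨v, hvi, hvj⟩ := hd
          obtain ⟨z, -, h, -⟩ := hR j hj
          simp only [Set.mem_iUnion]
          exact ⟨v, hvi, hj.1, h v hvj⟩)
      have hdisj : ∀ i ∈ J', ∀ j ∈ J', i ≠ j → Disjoint (R i) (R j) := by
        intro i hi j hj hij
        rcases lt_or_gt_of_ne hij with h | h
        · exact not_not.1 (hind i hi j hj h)
        · exact (not_not.1 (hind j hj i hi h)).symm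
      refine ⟨c, hcT, J', fun j hj => (hJ' hj).1, hinf, fun j => insert c (R j : Set V),
        fun j hj => ?_, fun i hi j hj hij => ?_⟩
      · obtain ⟨z, hz, hRT, hn⟩ := hR j (hJ' hj)
        refine ⟨Set.insert_subset hcT fun v hv => (hRT v hv).left_mem, ?_⟩
        refine Near.succ_iff.2 ⟨.inl rfl, .inr ⟨z, hz, hn.mono (Set.subset_insert _ _) le_rfl⟩⟩
      · rintro v ⟨hvc | hvi, hvc | hvj⟩
        · exact hvc
        · exact hvc
        · exact hvc
        · exact absurd hvj (Finset.disjoint_left.1 (hdisj i hi j hj hij) hvi)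

/-- The index used to connect the `n`th and the `m`th even index. -/
def hubIndex (n m : ℕ) : ℕ := 2 * Nat.pair n m + 1

theorem lt_hubIndex_left (n m : ℕ) : 2 * n < hubIndex n m := by
  have := Nat.left_le_pair n m
  unfold hubIndex; omega

theorem lt_hubIndex_right (n m : ℕ) : 2 * m < hubIndex n m := by
  have := Nat.right_le_pair n m
  unfold hubIndex; omega

theorem hubIndex_inj {n m n' m' : ℕ} (h : hubIndex n m = hubIndex n' m') : n = n' ∧ m = m' := by
  unfold hubIndex at h
  exact Nat.pair_eq_pair.1 (by omega)

theorem hubIndex_ne_even {n m k : ℕ} : hubIndex n m ≠ 2 * k := by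
  unfold hubIndex; omega

/-- A graph with an infinite clique as a shallow minor has one as a topological shallow minor. -/
theorem IsShallowMinor.isTopShallowMinor_nat {d : ℕ}
    (h : IsShallowMinor d (SimpleGraph.completeGraph ℕ) G) :
    IsTopShallowMinor (2 * d + 1) (SimpleGraph.completeGraph ℕ) G := by
  obtain ⟨c, T, hc, hT, hE⟩ := h.exists_near
  have hE' : ∀ i j, ∃ x y, i ≠ j → Near G (T i) d (c i) x ∧ Near G (T j) d (c j) y ∧
      G.Adj x y := by
    intro i j
    by_cases hij : i = j
    · exact ⟨c i, c i, fun h => absurd hij h⟩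
    · obtain ⟨x, y, h⟩ := hE i j hij
      exact ⟨x, y, fun _ => h⟩
  choose y z hyz using hE'
  -- Each selected branch set gets a root `x` with a fan to the attachment vertices of all later
  -- selected branch sets.
  obtain ⟨g, hg, -, hgood⟩ := exists_diagonal_seq
    (fun i J => ∃ x ∈ T i, ∃ Q : ℕ → Set V, (∀ j ∈ J, Q j ⊆ T i ∧ Near G (Q j) d x (y i j)) ∧
      ∀ j ∈ J, ∀ k ∈ J, j ≠ k → Q j ∩ Q k ⊆ {x})
    (by
      rintro i J J' hJ ⟨x, hx, Q, hQ, hQd⟩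
      exact ⟨x, hx, Q, fun j hj => hQ j (hJ hj), fun j hj k hk => hQd j (hJ hj) k (hJ hk)⟩)
    (by
      intro i J hJ
      obtain ⟨x, hx, J', hJ', hinf, Q, hQ⟩ := exists_fan (G := G) (T := T i) (y i) d (c := c i)
        (hJ.sdiff (Set.finite_singleton i)) (fun j hj => (hyz i j (Ne.symm hj.2)).1)
      exact ⟨J', hJ'.trans Set.sdiff_subset, hinf, x, hx, Q, hQ⟩) Set.infinite_univ
  choose x hx Q hQ hQd using hgood
  -- the fan of the `i`th branch set, towards the `j`th branch set
  set F : ℕ → ℕ → Set V := fun i j => Q i (g j) with hF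
  have hFT : ∀ {i j}, i < j → F i j ⊆ T (g i) := fun {i j} h => (hQ i _ ⟨j, h, rfl⟩).1
  have hFx : ∀ {i j}, i < j → Near G (F i j) d (x i) (y (g i) (g j)) :=
    fun {i j} h => (hQ i _ ⟨j, h, rfl⟩).2
  have hFd : ∀ {i j k}, i < j → i < k → j ≠ k → F i j ∩ F i k ⊆ {x i} :=
    fun {i j k} hj hk hne => hQd i _ ⟨j, hj, rfl⟩ _ ⟨k, hk, rfl⟩ (hg.injective.ne hne)
  have hTe : ∀ {i j v}, v ∈ T (g i) → v ∈ T (g j) → i = j := by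
    intro i j v hi hj
    by_contra hne
    exact Set.disjoint_left.1 (hT _ _ (hg.injective.ne hne)) hi hj
  -- Roots of even index are the branch vertices; the branch set of odd index `hubIndex n m` is
  -- reserved for the pair `(n, m)`. It comes after both ends, so both fans reach it. A link has
  -- length at most `d + 1 + 2 * d + 1 + d`, passing through the center of the hub.
  refine isTopShallowMinor_of_link (fun n => x (2 * n)) ?_
    (fun n m => F (2 * n) (hubIndex n m) ∪ T (g (hubIndex n m)) ∪ F (2 * m) (hubIndex n m))
    ?_ ?_ ?_
  · intro n m hnm
    have := hTe (hx (2 * n)) ((show x (2 * n) = x (2 * m) from hnm) ▸ hx (2 * m))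
    omega
  · intro n m hnm
    set k := hubIndex n m with hk
    have hn := lt_hubIndex_left n m
    have hm := lt_hubIndex_right n m
    obtain ⟨-, hn2, hn3⟩ := hyz (g (2 * n)) (g k) (hg.injective.ne (by omega))
    obtain ⟨-, hm2, hm3⟩ := hyz (g (2 * m)) (g k) (hg.injective.ne (by omega))
    have s1 : F (2 * n) k ⊆ F (2 * n) k ∪ T (g k) ∪ F (2 * m) k := fun v hv => .inl (.inl hv)
    have s2 : T (g k) ⊆ F (2 * n) k ∪ T (g k) ∪ F (2 * m) k := fun v hv => .inl (.inr hv)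
    have s3 : F (2 * m) k ⊆ F (2 * n) k ∪ T (g k) ∪ F (2 * m) k := fun v hv => .inr hv
    have p1 := (hFx hn).mono s1 le_rfl
    have p5 := (hFx hm).mono s3 le_rfl
    have p3 := (hn2.symm.trans hm2).mono s2 le_rfl
    have p2 := Near.of_adj hn3 p1.right_mem p3.left_mem
    have p4 := Near.of_adj hm3 p5.right_mem p3.right_mem
    exact ((((p1.trans p2).trans p3).trans p4.symm).trans p5.symm).mono subset_rfl (by omega)
  · intro n m hnm l hl
    have hn := lt_hubIndex_left n m
    have hm := lt_hubIndex_right n m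
    rcases hl with (hl | hl) | hl
    · have := hTe (hx (2 * l)) (hFT hn hl); omega
    · exact absurd (hTe hl (hx (2 * l))) hubIndex_ne_even
    · have := hTe (hx (2 * l)) (hFT hm hl); omega
  · intro n m n' m' hnm hnm' hne v hv hv'
    have hkk : hubIndex n m ≠ hubIndex n' m' := fun h => hne (by
      obtain ⟨rfl, rfl⟩ := hubIndex_inj h; rfl)
    -- a vertex in two linking sets is a branch vertex of an end
    have hmem : ∀ {a b w}, w ∈ F (2 * a) (hubIndex a b) ∪ T (g (hubIndex a b)) ∪
        F (2 * b) (hubIndex a b) → w ∈ T (g (hubIndex a b)) ∨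
          ∃ e, (e = a ∨ e = b) ∧ w ∈ F (2 * e) (hubIndex a b) ∧ 2 * e < hubIndex a b := by
      rintro a b w ((h | h) | h)
      · exact .inr ⟨a, .inl rfl, h, lt_hubIndex_left a b⟩
      · exact .inl h
      · exact .inr ⟨b, .inr rfl, h, lt_hubIndex_right a b⟩
    rcases hmem hv with h | ⟨e, he, h, hlt⟩ <;> rcases hmem hv' with h' | ⟨e', he', h', hlt'⟩
    · exact absurd (hTe h h') hkk
    · exact absurd (hTe h (hFT hlt' h')) hubIndex_ne_even
    · exact absurd (hTe h' (hFT hlt h)) hubIndex_ne_even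
    · obtain rfl : e = e' := by have := hTe (hFT hlt h) (hFT hlt' h'); omega
      have hve : v = x (2 * e) := hFd hlt hlt' hkk ⟨h, h'⟩
      subst hve
      have hx2 : ∀ {a}, e = a → x (2 * e) = x (2 * a) := fun h => by rw [h]
      exact ⟨he.imp hx2 hx2, he'.imp hx2 hx2⟩

end

/-! ### Transfer between ultraproducts and their factors -/

section

variable {U : Ultrafilter ℕ} {V : ℕ → Type u} {G : ∀ n, SimpleGraph (V n)}

/-- A representative of an element of a filter product. -/
noncomputable def rep (x : (U : Filter ℕ).Product V) : ∀ n, V n := Quotient.out x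

/-- The element of a filter product represented by a sequence. -/
def germ (U : Ultrafilter ℕ) (a : ∀ n, V n) : (U : Filter ℕ).Product V :=
  Quotient.mk (Filter.productSetoid (U : Filter ℕ) V) a

theorem rep_germ (a : ∀ n, V n) : ∀ᶠ n in (U : Filter ℕ), rep (germ U a) n = a n :=
  Quotient.mk_out (s := Filter.productSetoid (U : Filter ℕ) V) a

theorem germ_rep (x : (U : Filter ℕ).Product V) : germ U (rep x) = x := Quotient.out_eq x

theorem eq_iff_rep {x y : (U : Filter ℕ).Product V} :
    x = y ↔ ∀ᶠ n in (U : Filter ℕ), rep x n = rep y n := by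
  conv_lhs => rw [← germ_rep x, ← germ_rep y]
  exact Quotient.eq (r := Filter.productSetoid (U : Filter ℕ) V)

theorem ultraproduct_adj {x y : (U : Filter ℕ).Product V} :
    (ultraproduct U G).Adj x y ↔ ∀ᶠ n in (U : Filter ℕ), (G n).Adj (rep x n) (rep y n) := by
  conv_lhs => rw [← germ_rep x, ← germ_rep y]
  rfl

/-- The existential step of Łoś's theorem: witnesses are chosen coordinatewise. All factors must be
nonempty because coordinates without a witness receive an arbitrary value. -/
theorem exists_rep_of_eventually [hV : ∀ n, Nonempty (V n)] {P : ∀ n, V n → Prop}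
    (h : ∀ᶠ n in (U : Filter ℕ), ∃ x, P n x) :
    ∃ x : (U : Filter ℕ).Product V, ∀ᶠ n in (U : Filter ℕ), P n (rep x n) := by
  classical
  refine ⟨germ U fun n => if h : ∃ x, P n x then h.choose else (hV n).some, ?_⟩
  filter_upwards [h, rep_germ (U := U) fun n =>
    if h : ∃ x, P n x then h.choose else (hV n).some] with n hn hr
  rw [hr, dif_pos hn]
  exact hn.choose_spec

/-- One direction of Łoś's theorem for a property that is first order because the length is bounded.
At each step the ultrafilter decides whether the walk stops or continues, and next vertices are
chosen coordinatewise. -/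
theorem near_ultraproduct {T : ∀ n, Set (V n)} {k : ℕ} {x y : (U : Filter ℕ).Product V}
    (h : ∀ᶠ n in (U : Filter ℕ), Near (G n) (T n) k (rep x n) (rep y n)) :
    Near (ultraproduct U G) {z | ∀ᶠ n in (U : Filter ℕ), rep z n ∈ T n} k x y := by
  have hV : ∀ n, Nonempty (V n) := fun n => ⟨rep x n⟩
  have hx : ∀ᶠ n in (U : Filter ℕ), rep x n ∈ T n := h.mono fun n hn => hn.left_mem
  induction k generalizing x with
  | zero =>
    obtain rfl : x = y := eq_iff_rep.2 (h.mono fun n hn => hn.eq_of_zero)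
    refine Near.refl ?_ 0
    exact hx
  | succ k ih =>
    rw [Near.succ_iff]
    refine ⟨hx, ?_⟩
    have h' := h.mono fun n hn => (Near.succ_iff.1 hn).2
    rw [Ultrafilter.eventually_or] at h'
    rcases h' with h' | h'
    · exact .inl (eq_iff_rep.2 h')
    · obtain ⟨z, hz⟩ := exists_rep_of_eventually h'
      exact .inr ⟨z, ultraproduct_adj.2 (hz.mono fun n hn => hn.1),
        ih (hz.mono fun n hn => hn.2) (hz.mono fun n hn => hn.2.left_mem)⟩

/-- Finite subgraphs of an ultraproduct are contained in almost all factors. -/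
theorem eventually_copy_of_finite {s : Set ((U : Filter ℕ).Product V)} (hs : s.Finite) :
    ∀ᶠ n in (U : Filter ℕ), ((ultraproduct U G).induce s).IsContained (G n) := by
  have hinj : ∀ᶠ n in (U : Filter ℕ), ∀ x ∈ s, ∀ y ∈ s, rep x n = rep y n → x = y := by
    refine (Filter.eventually_all_finite hs).2 fun x _ =>
      (Filter.eventually_all_finite hs).2 fun y _ => ?_
    by_cases hxy : x = y
    · simp [hxy]
    · filter_upwards [Ultrafilter.eventually_not.2 fun h => hxy (eq_iff_rep.2 h)] with n hn h
      exact absurd h hn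
  have hadj : ∀ᶠ n in (U : Filter ℕ), ∀ x ∈ s, ∀ y ∈ s, (ultraproduct U G).Adj x y →
      (G n).Adj (rep x n) (rep y n) := by
    refine (Filter.eventually_all_finite hs).2 fun x _ =>
      (Filter.eventually_all_finite hs).2 fun y _ => ?_
    by_cases hxy : (ultraproduct U G).Adj x y
    · exact (ultraproduct_adj.1 hxy).mono fun n hn _ => hn
    · simp [hxy]
  filter_upwards [hinj, hadj] with n h1 h2
  exact ⟨⟨⟨fun x => rep x.1 n, fun {x y} h => h2 x x.2 y y.2 h⟩,
    fun x y h => Subtype.ext (h1 x x.2 y y.2 h)⟩⟩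

/-- Nonprincipality enters the proof only through this fact. -/
theorem eventually_ge_of_nonprincipal (hU : ∀ n : ℕ, {n} ∉ U) (k : ℕ) :
    ∀ᶠ n in (U : Filter ℕ), k ≤ n := by
  have : ∀ᶠ n in (U : Filter ℕ), ∀ i ∈ Set.Iio k, n ≠ i :=
    (Filter.eventually_all_finite (Set.finite_Iio k)).2 fun i _ =>
      Ultrafilter.eventually_not.2 fun h => hU i (by
        filter_upwards [h] with n hn using hn)
  filter_upwards [this] with n hn
  by_contra h
  exact hn n (by simpa using h) rfl

end

/-! ### Shallow minors in class limits -/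

theorem IsTopShallowMinor.exists_finite_induce {V : Type u} {G : SimpleGraph V} {W : Type v}
    [Finite W] {H : SimpleGraph W} {d : ℕ} (h : IsTopShallowMinor d H G) :
    ∃ s : Set V, s.Finite ∧ IsTopShallowMinor d H (G.induce s) := by
  obtain ⟨α, P, hs⟩ := isTopShallowMinor_iff.1 h
  refine ⟨Set.range α ∪ ⋃ (e : {e : W × W // H.Adj e.1 e.2}), {x | x ∈ (P _ _ e.2).support},
    (Set.finite_range α).union (Set.finite_iUnion fun e => List.finite_toSet _),
    isTopShallowMinor_iff.2 ⟨_, _, hs.induce (fun w => .inl ⟨w, rfl⟩)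
      fun u w h x hx => .inr ?_⟩⟩
  exact Set.mem_iUnion.2 ⟨⟨(u, w), h⟩, hx⟩

/-- Compactness: a subdivision of a finite graph occupies finitely many vertices of the
ultraproduct, and such a part embeds into some factor. -/
theorem InLimit.exists_isTopShallowMinor {U : Ultrafilter ℕ} {C : Set FiniteGraph.{u}}
    {V : Type u} {G : SimpleGraph V} (hG : InLimit U C G) {W : Type v} [Finite W]
    {H : SimpleGraph W} {d : ℕ} (h : IsTopShallowMinor d H G) :
    ∃ F ∈ C, IsTopShallowMinor d H F.graph := by
  obtain ⟨F, hF, ⟨f⟩⟩ := hG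
  obtain ⟨s, hs, h'⟩ := (h.mono_right f).exists_finite_induce
  obtain ⟨n, ⟨g⟩⟩ := (eventually_copy_of_finite hs).exists
  exact ⟨F n, hF n, h'.mono_right g⟩

theorem exists_copy_completeGraph (H : FiniteGraph.{u}) :
    Nonempty (SimpleGraph.Copy H.graph (SimpleGraph.completeGraph (Fin (Nat.card H.V)))) := by
  have := H.finite
  have e := Finite.equivFin H.V
  exact ⟨⟨⟨e, fun {x y} h => e.injective.ne h.ne⟩, e.injective⟩⟩

theorem exists_copy_completeGraph_of_injective {ι κ : Type*} {f : ι → κ}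
    (hf : Function.Injective f) :
    Nonempty (SimpleGraph.Copy (SimpleGraph.completeGraph ι) (SimpleGraph.completeGraph κ)) :=
  ⟨⟨⟨f, fun {_ _} h => hf.ne h⟩, hf⟩⟩

/-- The complete graph on `t` vertices as a finite graph in an arbitrary universe. -/
def finiteClique (t : ℕ) : FiniteGraph.{u} where
  V := ULift.{u} (Fin t)
  finite := inferInstance
  graph := SimpleGraph.completeGraph _

/-- Every finite graph lies in a clique on `Fin n`, whose linear order allows subdivided edges to be
contracted into their smaller end. -/
theorem TopSomewhereDense.somewhereDense {C : Set FiniteGraph.{u}} (h : TopSomewhereDense C) :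
    SomewhereDense C := by
  obtain ⟨d, h⟩ := h
  refine ⟨2 * d + 1, fun H => ?_⟩
  obtain ⟨G, hG, hm⟩ := h (finiteClique (Nat.card H.V))
  obtain ⟨f⟩ := exists_copy_completeGraph_of_injective (ULift.up_injective (α := Fin (Nat.card H.V)))
  obtain ⟨g⟩ := exists_copy_completeGraph H
  exact ⟨G, hG, (hm.mono_left f).isShallowMinor.mono_left g⟩

/-- A graph missed at depth `d` lies in a clique on as many vertices, which is then missed by all
limit graphs at once. This uniformity is what makes the margin of quasi-wideness independent of the
graph. -/
theorem TopNowhereDense.exists_bound {C : Set FiniteGraph.{u}} (h : TopNowhereDense C)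
    (U : Ultrafilter ℕ) (d : ℕ) : ∃ t : ℕ, ∀ (V : Type u) (G : SimpleGraph V), InLimit U C G →
      ¬ IsTopShallowMinor d (SimpleGraph.completeGraph (Fin t)) G := by
  simp only [TopNowhereDense, TopSomewhereDense, not_exists, not_forall] at h
  obtain ⟨H, hH⟩ := h d
  refine ⟨Nat.card H.V, fun V G hG hm => ?_⟩
  obtain ⟨F, hF, hm'⟩ := hG.exists_isTopShallowMinor hm
  obtain ⟨f⟩ := exists_copy_completeGraph H
  exact hH F ⟨hF, hm'.mono_left f⟩

theorem LimitTopSomewhereDense.topSomewhereDense {U : Ultrafilter ℕ} {C : Set FiniteGraph.{u}}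
    (h : LimitTopSomewhereDense U C) : TopSomewhereDense C := by
  by_contra hC
  obtain ⟨d, V, G, hG, hm⟩ := h
  obtain ⟨t, ht⟩ := TopNowhereDense.exists_bound hC U d
  obtain ⟨f⟩ := exists_copy_completeGraph_of_injective (Fin.val_injective (n := t))
  exact ht V G hG (hm.mono_left f)

theorem LimitSomewhereDense.limitTopSomewhereDense {U : Ultrafilter ℕ} {C : Set FiniteGraph.{u}}
    (h : LimitSomewhereDense U C) : LimitTopSomewhereDense U C := by
  obtain ⟨d, V, G, hG, hm⟩ := h
  exact ⟨_, V, G, hG, hm.isTopShallowMinor_nat⟩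

/-- The factor of index `n` carries a clique minor on `n + 1` vertices. Its branch sets, taken
coordinatewise, define branch sets in the ultraproduct; the conditions on a fixed pair `i`, `j` hold
as soon as `n` exceeds both. -/
theorem SomewhereDense.limitSomewhereDense {U : Ultrafilter ℕ} (hU : ∀ n : ℕ, {n} ∉ U)
    {C : Set FiniteGraph.{u}} (h : SomewhereDense C) : LimitSomewhereDense U C := by
  obtain ⟨d, h⟩ := h
  have h' : ∀ n, ∃ F ∈ C, ∃ (c : ℕ → F.V) (T : ℕ → Set F.V), (∀ i, c i ∈ T i) ∧
      (∀ i j, i ≤ n → j ≤ n → i ≠ j → Disjoint (T i) (T j)) ∧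
      ∀ i j, i ≤ n → j ≤ n → i ≠ j → ∃ x y, Near F.graph (T i) d (c i) x ∧
        Near F.graph (T j) d (c j) y ∧ F.graph.Adj x y := by
    intro n
    obtain ⟨F, hF, hm⟩ := h (finiteClique (n + 1))
    obtain ⟨c, T, hc, hT, hE⟩ := hm.exists_near
    -- Indices above `n` are clamped to `n`; nothing is claimed about pairs involving them.
    let e : ℕ → (finiteClique (n + 1)).V := fun i => ULift.up ⟨min i n, by omega⟩
    have he : ∀ i j, i ≤ n → j ≤ n → i ≠ j → e i ≠ e j := by
      intro i j hi hj hij h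
      have := congrArg (fun z : ULift (Fin (n + 1)) => z.down.val) h
      simp only [e] at this
      omega
    exact ⟨F, hF, fun i => c (e i), fun i => T (e i), fun i => hc _,
      fun i j hi hj hij => hT _ _ (he i j hi hj hij),
      fun i j hi hj hij => hE _ _ (he i j hi hj hij)⟩
  choose F hF c T hc hT hE using h'
  refine ⟨d, _, ultraproduct U fun n => (F n).graph, ⟨F, hF, .rfl⟩, ?_⟩
  have hV : ∀ n, Nonempty (F n).V := fun n => ⟨c n 0⟩
  have hcr := fun i => rep_germ (U := U) fun n => c n i
  refine isShallowMinor_of_near (fun i => germ U fun n => c n i)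
    (fun i => {x | ∀ᶠ n in (U : Filter ℕ), rep x n ∈ T n i}) (fun i => ?_) (fun i j hij => ?_)
    (fun i j hij => ?_)
  · filter_upwards [hcr i] with n hn
    rw [hn]
    exact hc n i
  · rw [Set.disjoint_left]
    intro x hi hj
    obtain ⟨n, h1, h2, h3, h4⟩ := (hi.and (hj.and ((eventually_ge_of_nonprincipal hU i).and
      (eventually_ge_of_nonprincipal hU j)))).exists
    exact Set.disjoint_left.1 (hT n i j h3 h4 hij) h1 h2
  · obtain ⟨x, hx⟩ := exists_rep_of_eventually (U := U)
      (((eventually_ge_of_nonprincipal hU i).and (eventually_ge_of_nonprincipal hU j)).mono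
        fun n hn => hE n i j hn.1 hn.2 hij)
    obtain ⟨y, hy⟩ := exists_rep_of_eventually hx
    refine ⟨x, y, near_ultraproduct ?_, near_ultraproduct ?_,
      ultraproduct_adj.2 (hy.mono fun n hn => hn.2.2)⟩
    · filter_upwards [hy, hcr i] with n hn h
      rw [h]
      exact hn.1
    · filter_upwards [hy, hcr j] with n hn h
      rw [h]
      exact hn.2.1

/-! ### Scattered sets in graphs without shallow infinite cliques -/

/-- The vertex `v` has a neighbor in `B`. -/
def Touches {V : Type u} (G : SimpleGraph V) (v : V) (B : Set V) : Prop :=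
  ∃ b ∈ B, G.Adj v b

/-- A sequence of disjoint sets of vertices, each of radius at most `d` around its center. -/
structure IsBallFamily {V : Type u} (G : SimpleGraph V) (d : ℕ) (c : ℕ → V) (B : ℕ → Set V) :
    Prop where
  center_mem : ∀ i, c i ∈ B i
  near : ∀ i, ∀ v ∈ B i, Near G (B i) d (c i) v
  disjoint : ∀ i j, i ≠ j → Disjoint (B i) (B j)

namespace IsBallFamily

variable {V : Type u} {G : SimpleGraph V} {d : ℕ} {c : ℕ → V} {B : ℕ → Set V}

theorem comp (h : IsBallFamily G d c B) {g : ℕ → ℕ} (hg : Function.Injective g) :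
    IsBallFamily G d (fun i => c (g i)) (fun i => B (g i)) :=
  ⟨fun _ => h.center_mem _, fun _ => h.near _, fun _ _ hij => h.disjoint _ _ (hg.ne hij)⟩

theorem index_eq (h : IsBallFamily G d c B) {i j : ℕ} {v : V} (hi : v ∈ B i) (hj : v ∈ B j) :
    i = j := by
  by_contra hij
  exact Set.disjoint_left.1 (h.disjoint i j hij) hi hj

/-- Ramsey's theorem for adjacency of balls: infinitely many pairwise adjacent balls would be the
branch sets of an infinite clique. -/
theorem exists_seq_not_adj (h : IsBallFamily G d c B)
    (hG : ¬ IsShallowMinor d (SimpleGraph.completeGraph ℕ) G) :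
    ∃ g : ℕ → ℕ, StrictMono g ∧ ∀ i j, i ≠ j → ∀ a ∈ B (g i), ¬ Touches G a (B (g j)) := by
  obtain ⟨g, hg, hr | hr⟩ :=
    exists_homogeneous_seq fun i j => ∃ a ∈ B i, ∃ b ∈ B j, G.Adj a b
  · refine absurd ?_ hG
    have hb := h.comp hg.injective
    refine isShallowMinor_of_near _ _ hb.center_mem hb.disjoint fun i j hij => ?_
    rcases lt_or_gt_of_ne hij with h' | h'
    · obtain ⟨x, hx, y, hy, hxy⟩ := hr i j h'
      exact ⟨x, y, hb.near _ _ hx, hb.near _ _ hy, hxy⟩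
    · obtain ⟨x, hx, y, hy, hxy⟩ := hr j i h'
      exact ⟨y, x, hb.near _ _ hy, hb.near _ _ hx, hxy.symm⟩
  · refine ⟨g, hg, fun i j hij a ha => ?_⟩
    rintro ⟨b, hb, hab⟩
    rcases lt_or_gt_of_ne hij with h' | h'
    · exact hr i j h' ⟨a, ha, b, hb, hab⟩
    · exact hr j i h' ⟨b, hb, a, ha, hab.symm⟩

/-- Each pair of vertices is joined through a ball of its own, chosen by the pairing function, by a
walk of length at most `1 + 2 * d + 1`. -/
theorem isTopShallowMinor_of_touches (h : IsBallFamily G d c B) {t : ℕ} {α : Fin t → V}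
    (hα : Function.Injective α) (hαB : ∀ a i, α a ∉ B i) (ht : ∀ a i, Touches G (α a) (B i)) :
    IsTopShallowMinor (d + 1) (SimpleGraph.completeGraph (Fin t)) G := by
  refine isTopShallowMinor_of_link α hα
    (fun a b => insert (α a) (insert (α b) (B (Nat.pair a b)))) ?_ ?_ ?_
  · intro a b hab
    obtain ⟨p, hp, hap⟩ := ht a (Nat.pair a b)
    obtain ⟨q, hq, hbq⟩ := ht b (Nat.pair a b)
    have hsub : B (Nat.pair a b) ⊆ insert (α a) (insert (α b) (B (Nat.pair a b))) :=
      fun v hv => .inr (.inr hv)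
    have p2 := (h.near _ _ hp).symm.trans (h.near _ _ hq) |>.mono hsub le_rfl
    have p1 := Near.of_adj hap (.inl rfl) p2.left_mem
    have p3 := Near.of_adj hbq (.inr (.inl rfl)) p2.right_mem
    exact ((p1.trans p2).trans p3.symm).mono subset_rfl (by omega)
  · rintro a b hab k (hk | hk | hk)
    · exact .inl (hα hk)
    · exact .inr (hα hk)
    · exact absurd hk (hαB _ _)
  · intro a b a' b' hab hab' hne x hx hx'
    have hB : ∀ e i, x = α e → x ∉ B i := fun e i he => he ▸ hαB e i
    rcases hx with hx | hx | hx <;> rcases hx' with hx' | hx' | hx'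
    · exact ⟨.inl hx, .inl hx'⟩
    · exact ⟨.inl hx, .inr hx'⟩
    · exact absurd hx' (hB _ _ hx)
    · exact ⟨.inr hx, .inl hx'⟩
    · exact ⟨.inr hx, .inr hx'⟩
    · exact absurd hx' (hB _ _ hx)
    · exact absurd hx (hB _ _ hx')
    · exact absurd hx (hB _ _ hx')
    · obtain ⟨h1, h2⟩ := Nat.pair_eq_pair.1 (h.index_eq hx hx')
      exact absurd (Prod.ext (Fin.ext h1) (Fin.ext h2)) hne

/-- After deleting few vertices and passing to a subsequence, every vertex has neighbors in only
finitely many of the balls that do not contain it. -/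
theorem exists_finset_touches_finite (h : IsBallFamily G d c B) {t : ℕ}
    (hG : ¬ IsTopShallowMinor (d + 1) (SimpleGraph.completeGraph (Fin t)) G) :
    ∃ R : Finset V, R.card < t ∧ ∃ g : ℕ → ℕ, StrictMono g ∧ (∀ v ∈ R, ∀ i, v ∉ B (g i)) ∧
      ∀ v ∉ R, {i | v ∉ B (g i) ∧ Touches G v (B (g i))}.Finite := by
  classical
  -- Sets of `k` vertices that all touch the same infinitely many balls exist for `k = 0` but not
  -- for `k = t`. At the last `k` before failure, a further vertex touching infinitely many of the
  -- remaining balls could be added to `R`.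
  let Hub : ℕ → Prop := fun k => ∃ R : Finset V, R.card = k ∧ ∃ J : Set ℕ, J.Infinite ∧
    ∀ v ∈ R, ∀ j ∈ J, v ∉ B j ∧ Touches G v (B j)
  have h0 : Hub 0 := ⟨∅, rfl, Set.univ, Set.infinite_univ, by simp⟩
  have ht : ¬ Hub t := by
    rintro ⟨R, hR, J, hJ, hRJ⟩
    refine hG ((h.comp (Nat.nth_injective hJ)).isTopShallowMinor_of_touches
      (α := fun a => (R.equivFinOfCardEq hR).symm a) ?_ ?_ ?_)
    · exact Subtype.val_injective.comp (Equiv.injective _)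
    · exact fun a i => (hRJ _ (Subtype.coe_prop _) _ (Nat.nth_mem_of_infinite hJ i)).1
    · exact fun a i => (hRJ _ (Subtype.coe_prop _) _ (Nat.nth_mem_of_infinite hJ i)).2
  obtain ⟨k, hkt, hk, hk'⟩ : ∃ k < t, Hub k ∧ ¬ Hub (k + 1) := by
    by_contra hcon
    push Not at hcon
    refine ht (Nat.le_induction (m := 0) (P := fun n _ => n ≤ t → Hub n) (fun _ => h0) ?_ t
      (Nat.zero_le t) le_rfl)
    exact fun n _ ih hn => hcon n (by omega) (ih (by omega))
  obtain ⟨R, hR, J, hJ, hRJ⟩ := hk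
  refine ⟨R, hR ▸ hkt, Nat.nth (· ∈ J), Nat.nth_strictMono hJ,
    fun v hv i => (hRJ v hv _ (Nat.nth_mem_of_infinite hJ i)).1, fun v hv => ?_⟩
  by_contra hinf
  refine hk' ⟨insert v R, by rw [Finset.card_insert_of_notMem hv, hR],
    {j | j ∈ J ∧ v ∉ B j ∧ Touches G v (B j)}, ?_, ?_⟩
  · refine (Set.Infinite.image (Nat.nth_injective hJ).injOn hinf).mono ?_
    rintro _ ⟨i, hi, rfl⟩
    exact ⟨Nat.nth_mem_of_infinite hJ i, hi⟩
  · intro w hw j hj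
    rcases Finset.mem_insert.1 hw with rfl | hw
    · exact hj.2
    · exact hRJ w hw j hj.1

/-- If any two balls have a common neighbor outside the balls, and each of these vertices
touches finitely many balls, then there is an infinite clique minor. -/
theorem isShallowMinor_of_common_neighbors (h : IsBallFamily G d c B) (v : ℕ → ℕ → V)
    (hv : ∀ i j, i < j → Touches G (v i j) (B i) ∧ Touches G (v i j) (B j))
    (hvB : ∀ i j, i < j → ∀ k, v i j ∉ B k)
    (hfin : ∀ i j, i < j → {k | Touches G (v i j) (B k)}.Finite) :
    IsShallowMinor (3 * d + 3) (SimpleGraph.completeGraph ℕ) G := by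
  -- The balls are thinned out so that the connecting vertex of a pair touches no ball after the
  -- pair. Therefore a connecting vertex determines the larger index of its pair (`hwne`).
  obtain ⟨g, hg, -, hgood⟩ := exists_diagonal_seq
    (fun n J => ∀ j ≤ n, ∀ i < j, ∀ k ∈ J, ¬ Touches G (v i j) (B k))
    (fun n J J' hJ h j hj i hi k hk => h j hj i hi k (hJ hk))
    (fun n J hJ => by
      refine ⟨J \ ⋃ j ∈ Set.Iic n, ⋃ i ∈ Set.Iio j, {k | Touches G (v i j) (B k)},
        Set.sdiff_subset, hJ.sdiff ?_, fun j hj i hi k hk ht => hk.2 ?_⟩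
      · exact (Set.finite_Iic n).biUnion fun j _ => (Set.finite_Iio j).biUnion fun i hi =>
          hfin i j hi
      · simp only [Set.mem_iUnion]
        exact ⟨j, hj, i, hi, ht⟩) Set.infinite_univ
  set w : ℕ → ℕ → V := fun i j => v (g i) (g j) with hw
  have hb := h.comp hg.injective
  set D : ℕ → Set V := fun i => B (g i) with hD
  have hwD : ∀ {i j k}, i < j → w i j ∉ D k := fun hij => hvB _ _ (hg hij) _
  have hw1 : ∀ {i j}, i < j → Touches G (w i j) (D i) := fun hij => (hv _ _ (hg hij)).1
  have hw2 : ∀ {i j}, i < j → Touches G (w i j) (D j) := fun hij => (hv _ _ (hg hij)).2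
  have hwne : ∀ {i j i' j'}, i < j → i' < j' → w i j = w i' j' → j = j' := by
    have key : ∀ {i j i' j'}, i < j → i' < j' → w i j = w i' j' → ¬ j < j' := by
      intro i j i' j' hij hij' he hlt
      refine hgood j (g j) le_rfl (g i) (hg hij) (g j') ⟨j', hlt, rfl⟩ ?_
      have := hw2 hij'
      rwa [← he] at this
    intro i j i' j' hij hij' he
    have h1 := key hij hij' he
    have h2 := key hij' hij he.symm
    omega
  set L : ℕ → ℕ → Set V := fun n m =>
    insert (w (2 * n) (hubIndex n m)) (insert (w (2 * m) (hubIndex n m)) (D (hubIndex n m)))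
    with hL
  -- Balls of even index are the cores of the branch sets, and the odd ball `hubIndex n m` with its
  -- two connecting vertices is an arm of the `n`th branch set towards the `m`th. From the center,
  -- the tip of the arm is reached within `d + 1 + 1 + 2 * d + 1` steps.
  set T : ℕ → Set V := fun n => D (2 * n) ∪ ⋃ m, L n m with hT
  have hDL : ∀ {k n m x}, x ∈ D (2 * k) → x ∉ L n m := by
    rintro k n m x hx (rfl | rfl | hx')
    · exact hwD (lt_hubIndex_left n m) hx
    · exact hwD (lt_hubIndex_right n m) hx
    · exact hubIndex_ne_even (hb.index_eq hx' hx)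
  have hLL : ∀ {n m n' m' x}, x ∈ L n m → x ∈ L n' m' → n = n' := by
    intro n m n' m' x hx hx'
    have hform : ∀ {a b}, x ∈ L a b →
        (∃ e, e < hubIndex a b ∧ x = w e (hubIndex a b)) ∨ x ∈ D (hubIndex a b) := by
      rintro a b (hx | hx | hx)
      · exact .inl ⟨_, lt_hubIndex_left a b, hx⟩
      · exact .inl ⟨_, lt_hubIndex_right a b, hx⟩
      · exact .inr hx
    suffices hubIndex n m = hubIndex n' m' from (hubIndex_inj this).1
    rcases hform hx with ⟨e, he, h1⟩ | h1 <;> rcases hform hx' with ⟨e', he', h2⟩ | h2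
    · exact hwne he he' (h1.symm.trans h2)
    · exact absurd h2 (h1 ▸ hwD he)
    · exact absurd h1 (h2 ▸ hwD he')
    · exact hb.index_eq h1 h2
  have hlink : ∀ n m, n < m → ∃ x y, Near G (T n) (3 * d + 3) (c (g (2 * n))) x ∧
      Near G (T m) (3 * d + 3) (c (g (2 * m))) y ∧ G.Adj x y := by
    intro n m hnm
    set k := hubIndex n m with hk
    have hn : 2 * n < k := lt_hubIndex_left n m
    have hm : 2 * m < k := lt_hubIndex_right n m
    obtain ⟨p, hp, hp'⟩ := hw1 hn
    obtain ⟨q, hq, hq'⟩ := hw2 hn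
    obtain ⟨r, hr, hr'⟩ := hw2 hm
    obtain ⟨y, hy, hy'⟩ := hw1 hm
    have hLT : L n m ⊆ T n := fun z hz => .inr (Set.mem_iUnion.2 ⟨m, hz⟩)
    have s1 : D (2 * n) ⊆ T n := fun z hz => .inl hz
    have s2 : D k ⊆ T n := fun z hz => hLT (.inr (.inr hz))
    have m1 : w (2 * n) k ∈ T n := hLT (.inl rfl)
    have m2 : w (2 * m) k ∈ T n := hLT (.inr (.inl rfl))
    refine ⟨w (2 * m) k, y, ?_, (hb.near _ _ hy).mono (fun z hz => .inl hz) (by omega), hy'⟩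
    have p1 := (hb.near _ _ hp).mono s1 le_rfl
    have p2 := Near.of_adj hp' m1 p1.right_mem
    have p4 := ((hb.near _ _ hq).symm.trans (hb.near _ _ hr)).mono s2 le_rfl
    have p3 := Near.of_adj hq' m1 p4.left_mem
    have p5 := Near.of_adj hr' m2 p4.right_mem
    exact ((((p1.trans p2.symm).trans p3).trans p4).trans p5.symm).mono subset_rfl (by omega)
  refine isShallowMinor_of_near (fun n => c (g (2 * n))) T (fun n => .inl (hb.center_mem _))
    (fun n n' hne => ?_) (fun n m hnm => ?_)
  · rw [Set.disjoint_left]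
    rintro x (hx | hx) (hx' | hx')
    · have := hb.index_eq hx hx'; omega
    · obtain ⟨m, hm⟩ := Set.mem_iUnion.1 hx'
      exact hDL hx hm
    · obtain ⟨m, hm⟩ := Set.mem_iUnion.1 hx
      exact hDL hx' hm
    · obtain ⟨m, hm⟩ := Set.mem_iUnion.1 hx
      obtain ⟨m', hm'⟩ := Set.mem_iUnion.1 hx'
      exact hne (hLL hm hm')
  · rcases lt_or_gt_of_ne hnm with h' | h'
    · exact hlink n m h'
    · obtain ⟨x, y, hx, hy, hxy⟩ := hlink m n h'
      exact ⟨y, x, hy, hx, hxy.symm⟩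

end IsBallFamily

section

variable {V : Type u} {G : SimpleGraph V}

/-- The radius of a scattered sequence can be increased at the cost of deleting few vertices. -/
theorem exists_scattered_subseq (hG : ∀ d, ¬ IsShallowMinor d (SimpleGraph.completeGraph ℕ) G)
    {d t : ℕ} (ht : ¬ IsTopShallowMinor (d + 1) (SimpleGraph.completeGraph (Fin t)) G)
    {S : Set V} {x : ℕ → V} (hxS : ∀ i, x i ∉ S)
    (hx : ∀ i j, i < j → ¬ Near G Sᶜ (2 * d) (x i) (x j)) :
    ∃ R : Finset V, R.card < t ∧ ∃ g : ℕ → ℕ, StrictMono g ∧ (∀ i, x (g i) ∉ R) ∧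
      ∀ i j, i < j → ¬ Near G (S ∪ R)ᶜ (2 * (d + 1)) (x (g i)) (x (g j)) := by
  have hb₀ : IsBallFamily G d x fun i => {v | Near G Sᶜ d (x i) v} := by
    refine ⟨fun i => Near.refl (hxS i) d, fun i v hv => Near.within hv, fun i j hij => ?_⟩
    rw [Set.disjoint_left]
    intro v hi hj
    have h1 : Near G Sᶜ (2 * d) (x i) (x j) :=
      (Near.trans hi (Near.symm hj)).mono subset_rfl (by omega)
    rcases lt_or_gt_of_ne hij with h | h
    exacts [hx i j h h1, hx j i h h1.symm]
  obtain ⟨g₁, hg₁, hna⟩ := hb₀.exists_seq_not_adj (hG d)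
  have hb₁ := hb₀.comp hg₁.injective
  obtain ⟨R, hR, g₂, hg₂, hRB, hfin⟩ := hb₁.exists_finset_touches_finite ht
  have hb₂ := hb₁.comp hg₂.injective
  set B : ℕ → Set V := fun i => {v | Near G Sᶜ d (x (g₁ (g₂ i))) v} with hB
  have hna' : ∀ i j, i ≠ j → ∀ a ∈ B i, ¬ Touches G a (B j) :=
    fun i j hij => hna _ _ (hg₂.injective.ne hij)
  obtain ⟨g₃, hg₃, hr | hr⟩ := exists_homogeneous_seq fun i j =>
    Near G (S ∪ R)ᶜ (2 * (d + 1)) (x (g₁ (g₂ i))) (x (g₁ (g₂ j)))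
  · exfalso
    have hSR : (S ∪ R)ᶜ ⊆ Sᶜ := Set.compl_subset_compl.2 Set.subset_union_left
    have key : ∀ i j, ∃ v, i < j → v ∉ R ∧ v ∉ B (g₃ i) ∧ v ∉ B (g₃ j) ∧
        Touches G v (B (g₃ i)) ∧ Touches G v (B (g₃ j)) := by
      intro i j
      by_cases hij : i < j
      swap
      · exact ⟨x 0, fun h => absurd h hij⟩
      have hne : g₃ i ≠ g₃ j := (hg₃ hij).ne
      have h1 := hr i j hij
      -- The ends `p` and `q` of the two outer pieces lie in the two balls. As these are disjoint
      -- and nonadjacent, the middle vertex `v` lies in neither and is a common neighbor of both.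
      rw [show 2 * (d + 1) = d + (1 + (1 + d)) by ring] at h1
      obtain ⟨p, hp, h1⟩ := h1.split
      obtain ⟨v, hpv, h1⟩ := h1.split
      obtain ⟨q, hvq, h1⟩ := h1.split
      have hpB : p ∈ B (g₃ i) := hp.mono hSR le_rfl
      have hqB : q ∈ B (g₃ j) := h1.symm.mono hSR le_rfl
      have hnotboth : ∀ z, z ∈ B (g₃ i) → z ∈ B (g₃ j) → False :=
        fun z h h' => hne (hb₂.index_eq h h')
      have hvi : v ∉ B (g₃ i) := by
        intro hv
        rcases hvq.eq_or_adj with rfl | h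
        · exact hnotboth _ hv hqB
        · exact hna' _ _ hne v hv ⟨q, hqB, h⟩
      have hvj : v ∉ B (g₃ j) := by
        intro hv
        rcases hpv.eq_or_adj with rfl | h
        · exact hnotboth _ hpB hv
        · exact hna' _ _ hne p hpB ⟨v, hv, h⟩
      refine ⟨v, fun _ => ⟨fun h => hvq.left_mem (.inr h), hvi, hvj, ⟨p, hpB, ?_⟩, q, hqB, ?_⟩⟩
      · rcases hpv.eq_or_adj with rfl | h
        exacts [absurd hpB hvi, h.symm]
      · rcases hvq.eq_or_adj with rfl | h
        exacts [absurd hqB hvj, h]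
    choose v hv using key
    -- A third ball containing the connecting vertex would be adjacent to the `i`th ball.
    have hvB : ∀ i j, i < j → ∀ k, v i j ∉ B (g₃ k) := by
      intro i j hij k hk
      obtain ⟨-, hi, -, hti, -⟩ := hv i j hij
      by_cases hki : k = i
      · exact hi (hki ▸ hk)
      · exact hna' _ _ (hg₃.injective.ne hki) _ hk hti
    refine hG _ ((hb₂.comp hg₃.injective).isShallowMinor_of_common_neighbors v
      (fun i j hij => (hv i j hij).2.2.2) hvB fun i j hij => ?_)
    have := (hfin (v i j) (hv i j hij).1).preimage (f := g₃) hg₃.injective.injOn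
    exact this.subset fun k hk => ⟨hvB i j hij k, hk⟩
  · refine ⟨R, hR, fun i => g₁ (g₂ (g₃ i)), hg₁.comp (hg₂.comp hg₃), fun i hi => ?_, hr⟩
    exact hRB _ hi (g₃ i) (hb₂.center_mem (g₃ i))

end

/-- Induction on the radius. Raising it from `d` to `d + 1` adds to the margin the size `t` of a
clique excluded at depth `d + 1` throughout the class limit. Radius `0` asks only for distinct
vertices. -/
theorem exists_scattered_seq {U : Ultrafilter ℕ} {C : Set FiniteGraph.{u}}
    (hC : TopNowhereDense C) (hL : LimitNowhereDense U C) (d : ℕ) :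
    ∃ s : ℕ, ∀ (V : Type u) (G : SimpleGraph V), InLimit U C G → ∀ W : Set V, W.Infinite →
      ∃ S : Set V, S.encard ≤ s ∧ ∃ x : ℕ → V, Function.Injective x ∧ (∀ i, x i ∈ W) ∧
        (∀ i, x i ∉ S) ∧ ∀ i j, i < j → ¬ Near G Sᶜ (2 * d) (x i) (x j) := by
  induction d with
  | zero =>
    refine ⟨0, fun V G hG W hW => ⟨∅, by simp, ?_⟩⟩
    have := hW.to_subtype
    obtain ⟨f⟩ := Infinite.natEmbedding W
    rename_i hf
    exact ⟨fun i => f i, Subtype.val_injective.comp hf, fun i => (f i).2, fun i => by simp,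
      fun i j hij h => hij.ne (hf (Subtype.ext (Near.eq_of_zero h)))⟩
  | succ d ih =>
    obtain ⟨s, hs⟩ := ih
    obtain ⟨t, ht⟩ := hC.exists_bound U (d + 1)
    refine ⟨s + t, fun V G hG W hW => ?_⟩
    obtain ⟨S, hS, x, hinj, hxW, hxS, hx⟩ := hs V G hG W hW
    obtain ⟨R, hR, g, hg, hgR, hxg⟩ := exists_scattered_subseq
      (fun d' hm => hL ⟨d', V, G, hG, hm⟩) (ht V G hG) hxS hx
    refine ⟨S ∪ R, ?_, fun i => x (g i), hinj.comp hg.injective, fun i => hxW _, ?_, hxg⟩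
    · refine (Set.encard_union_le _ _).trans ?_
      rw [Nat.cast_add, Set.encard_coe_eq_coe_finsetCard]
      gcongr
    · rintro i (h | h)
      exacts [hxS _ h, hgR _ h]

theorem exists_stronglyUniformlyLimitQuasiWide {U : Ultrafilter ℕ} {C : Set FiniteGraph.{u}}
    (hC : TopNowhereDense C) (hL : LimitNowhereDense U C) :
    ∃ s : ℕ → ℕ, StronglyUniformlyLimitQuasiWide U C s := by
  choose s hs using exists_scattered_seq hC hL
  refine ⟨s, fun d V G hG W hW => ?_⟩
  obtain ⟨S, hS, x, hinj, hxW, hxS, hx⟩ := hs d V G hG W hW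
  have hinj' : Function.Injective fun i => (⟨x i, hxS i⟩ : (Sᶜ : Set V)) :=
    fun i j h => hinj (congrArg Subtype.val h)
  refine ⟨S, hS, Set.range fun i => (⟨x i, hxS i⟩ : (Sᶜ : Set V)), ?_,
    Set.infinite_range_of_injective hinj', ?_⟩
  · rw [isScatteredIn_iff]
    rintro _ ⟨i, rfl⟩ _ ⟨j, rfl⟩ hne
    rcases lt_or_gt_of_ne (fun h : i = j => hne (h ▸ rfl)) with h | h
    · exact hx i j h
    · exact fun hn => hx j i h hn.symm
  · rintro _ ⟨i, rfl⟩
    exact hxW i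

/-! ### Uniform quasi-wideness of finite graphs from the class limit -/

section

variable {V : Type u} {G : SimpleGraph V}

theorem exists_isScatteredIn {S Y : Set V} {d : ℕ} (hS : ∀ y ∈ Y, y ∉ S)
    (hY : ∀ x ∈ Y, ∀ y ∈ Y, x ≠ y → ¬ Near G Sᶜ (2 * d) x y) :
    ∃ X : Set (Sᶜ : Set V), IsScatteredIn G S d X ∧ X.encard = Y.encard ∧
      ∀ x ∈ X, (x : V) ∈ Y := by
  refine ⟨Subtype.val ⁻¹' Y, isScatteredIn_iff.2 fun x hx y hy hxy =>
    hY x hx y hy (Subtype.val_injective.ne hxy), ?_, fun x hx => hx⟩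
  rw [← Subtype.val_injective.encard_image, Subtype.image_preimage_coe,
    Set.inter_eq_right.2 (show Y ⊆ Sᶜ from hS)]

theorem exists_seq_mem_of_le_encard {W : Set V} {n : ℕ} (h : ((n + 1 : ℕ) : ℕ∞) ≤ W.encard) :
    ∃ e : ℕ → V, (∀ i, e i ∈ W) ∧ ∀ i j, i ≤ n → j ≤ n → e i = e j → i = j := by
  obtain ⟨t, htW, ht⟩ := Set.exists_subset_encard_eq h
  have htf : t.Finite := Set.finite_of_encard_eq_coe ht
  have : Finite t := htf
  have hcard : Nat.card t = n + 1 := by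
    rw [Nat.card_coe_set_eq, Set.ncard, ht]; rfl
  have e := Finite.equivFinOfCardEq hcard
  refine ⟨fun i => e.symm ⟨min i n, by omega⟩, fun i => htW (Subtype.coe_prop _),
    fun i j hi hj hij => ?_⟩
  have := e.symm.injective (Subtype.val_injective hij)
  rw [Fin.mk.injEq] at this
  omega

end

/-- Compactness: if no `N` works, counterexamples with ever larger `W n` have an ultraproduct with
an infinite set `W'`. Finitely many members of a scattered subset of `W'`, together with the bounded
deleted set, project to a scattered set in some factor, a contradiction. -/
theorem StronglyUniformlyLimitQuasiWide.uniformlyQuasiWide {U : Ultrafilter ℕ}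
    (hU : ∀ n : ℕ, {n} ∉ U) {C : Set FiniteGraph.{u}} {s : ℕ → ℕ}
    (h : StronglyUniformlyLimitQuasiWide U C s) : UniformlyQuasiWide C s := by
  classical
  intro d m
  by_contra hcon
  push Not at hcon
  choose F hF W hW hbad using fun n => hcon (n + 1)
  choose e heW heinj using fun n => exists_seq_mem_of_le_encard (hW n)
  set G := ultraproduct U fun n => (F n).graph with hG
  set W' : Set ((U : Filter ℕ).Product fun n => (F n).V) :=
    {x | ∀ᶠ n in (U : Filter ℕ), rep x n ∈ W n} with hW'
  have hinf : W'.Infinite := by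
    refine Set.infinite_of_injective_forall_mem (f := fun i => germ U fun n => e n i) ?_ ?_
    · intro i j hij
      obtain ⟨n, h1, h2, h3, h4, h5⟩ := ((eq_iff_rep.1 hij).and
        ((rep_germ fun n => e n i).and ((rep_germ fun n => e n j).and
          ((eventually_ge_of_nonprincipal hU i).and
            (eventually_ge_of_nonprincipal hU j))))).exists
      rw [h2, h3] at h1
      exact heinj n i j h4 h5 h1
    · intro i
      filter_upwards [rep_germ (U := U) fun n => e n i] with n hn
      rw [hn]
      exact heW n i
  obtain ⟨S, hS, X, hX, hXinf, hXW⟩ := h d _ G ⟨F, hF, .rfl⟩ W' hinf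
  rw [isScatteredIn_iff] at hX
  have hSfin : S.Finite := Set.finite_of_encard_le_coe hS
  obtain ⟨Y, hYX, hYm⟩ := hXinf.exists_subset_card_eq m
  have hYfin : (Y : Set (Sᶜ : Set _)).Finite := Y.finite_toSet
  have e1 : ∀ᶠ n in (U : Filter ℕ), ∀ y ∈ (Y : Set (Sᶜ : Set _)), ∀ s ∈ S,
      rep y.1 n ≠ rep s n := by
    refine (Filter.eventually_all_finite hYfin).2 fun y _ =>
      (Filter.eventually_all_finite hSfin).2 fun s hs => Ultrafilter.eventually_not.2 fun h => ?_
    exact y.2 ((eq_iff_rep.2 h) ▸ hs)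
  have e2 : ∀ᶠ n in (U : Filter ℕ), ∀ y ∈ (Y : Set (Sᶜ : Set _)), rep y.1 n ∈ W n :=
    (Filter.eventually_all_finite hYfin).2 fun y hy => hXW y (hYX hy)
  -- Short walks in almost all factors avoiding the projections of `S` would combine into a short
  -- walk avoiding `S`.
  have e3 : ∀ᶠ n in (U : Filter ℕ), ∀ x ∈ (Y : Set (Sᶜ : Set _)), ∀ y ∈ (Y : Set (Sᶜ : Set _)),
      x ≠ y → ¬ Near (F n).graph ((fun z => rep z n) '' S)ᶜ (2 * d) (rep x.1 n) (rep y.1 n) := by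
    refine (Filter.eventually_all_finite hYfin).2 fun x hx =>
      (Filter.eventually_all_finite hYfin).2 fun y hy => ?_
    by_cases hxy : x = y
    · simp [hxy]
    have : ∀ᶠ n in (U : Filter ℕ), ¬ Near (F n).graph ((fun z => rep z n) '' S)ᶜ (2 * d)
        (rep x.1 n) (rep y.1 n) := by
      refine Ultrafilter.eventually_not.2 fun hn => hX x (hYX hx) y (hYX hy) hxy ?_
      refine (near_ultraproduct hn).mono (fun z hz hzS => ?_) le_rfl
      obtain ⟨n, hn⟩ := Filter.Eventually.exists hz
      exact hn ⟨z, hzS, rfl⟩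
    exact this.mono fun n hn _ => hn
  have e4 : ∀ᶠ n in (U : Filter ℕ), ∀ x ∈ (Y : Set (Sᶜ : Set _)), ∀ y ∈ (Y : Set (Sᶜ : Set _)),
      rep x.1 n = rep y.1 n → x = y := by
    refine (Filter.eventually_all_finite hYfin).2 fun x hx =>
      (Filter.eventually_all_finite hYfin).2 fun y hy => ?_
    by_cases hxy : x = y
    · simp [hxy]
    · refine (Ultrafilter.eventually_not.2 fun h => hxy (Subtype.ext (eq_iff_rep.2 h))).mono ?_
      exact fun n hn h => absurd h hn
  obtain ⟨n, h1, h2, h3, h4⟩ := (e1.and (e2.and (e3.and e4))).exists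
  obtain ⟨Z, hZ, hZm, hZY⟩ := exists_isScatteredIn (G := (F n).graph) (d := d)
    (S := (fun z => rep z n) '' S)
    (Y := (fun y : (Sᶜ : Set _) => rep y.1 n) '' (Y : Set (Sᶜ : Set _)))
    (by
      rintro _ ⟨y, hy, rfl⟩ ⟨s, hs, hsy⟩
      exact h1 y hy s hs hsy.symm)
    (by
      rintro _ ⟨x, hx, rfl⟩ _ ⟨y, hy, rfl⟩ hxy
      exact h3 x hx y hy fun h => hxy (h ▸ rfl))
  obtain ⟨z, hz, hzW⟩ := hbad n _ ((Set.encard_image_le _ _).trans hS) Z hZ (by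
    rw [hZm, Set.InjOn.encard_image fun x hx y hy => h4 x hx y hy,
      Set.encard_coe_eq_coe_finsetCard, hYm])
  obtain ⟨y, hy, hyz⟩ := hZY z hz
  exact hzW (hyz ▸ h2 y hy)

/-! ### Splitter's strategy -/

section

variable {V : Type u} {G : SimpleGraph V}

open Classical in
/-- The vertices of some short walk from `x` to `y` in `T`, if there is one. -/
noncomputable def link (G : SimpleGraph V) (T : Set V) (d : ℕ) (x y : V) : Finset V :=
  if h : Near G T d x y then h.choose.support.toFinset else ∅

theorem card_link_le (T : Set V) (d : ℕ) (x y : V) : (link G T d x y).card ≤ d + 1 := by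
  classical
  unfold link
  split_ifs with h
  · refine (List.toFinset_card_le _).trans ?_
    rw [SimpleGraph.Walk.length_support]
    have := h.choose_spec.1
    omega
  · simp

theorem link_subset (T : Set V) (d : ℕ) (x y : V) : ∀ v ∈ link G T d x y, v ∈ T := by
  classical
  unfold link
  split_ifs with h
  · intro v hv
    exact h.choose_spec.2 v (List.mem_toFinset.1 hv)
  · simp

theorem near_link {T : Set V} {d : ℕ} {x y : V} (h : Near G T d x y) :
    Near G (link G T d x y : Set V) d x y := by
  classical
  refine ⟨h.choose, h.choose_spec.1, fun v hv => ?_⟩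
  rw [link, dif_pos h]
  exact List.mem_toFinset.2 hv

open Classical in
/-- Connector's new vertex together with links to it from all earlier vertices of connector. -/
noncomputable def linkAll (G : SimpleGraph V) (d : ℕ) : List (V × Finset V) → V → Finset V
  | [], v => {v}
  | (w, _) :: h, v => linkAll G d h v ∪ link G (arena G d h) d w v

theorem card_linkAll_le (d : ℕ) (h : List (V × Finset V)) (v : V) :
    (linkAll G d h v).card ≤ 1 + h.length * (d + 1) := by
  classical
  induction h with
  | nil => simp [linkAll]
  | cons a h ih =>
    obtain ⟨w, W⟩ := a
    rw [linkAll]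
    refine (Finset.card_union_le _ _).trans ?_
    have := card_link_le (G := G) (arena G d h) d w v
    rw [List.length_cons, Nat.add_mul]
    omega

theorem mem_linkAll (d : ℕ) (h : List (V × Finset V)) (v : V) : v ∈ linkAll G d h v := by
  classical
  induction h with
  | nil => simp [linkAll]
  | cons a h ih =>
    obtain ⟨w, W⟩ := a
    rw [linkAll]
    exact Finset.mem_union_left _ ih

open Classical in
/-- Splitter deletes all links to connector's new vertex, during the first `L` rounds. -/
noncomputable def linkStrategy (G : SimpleGraph V) (d : ℕ) (L : ℕ∞)
    (h : List (V × Finset V)) (v : V) : Finset V :=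
  if (h.length : ℕ∞) < L then (linkAll G d h v).filter (· ∈ arena G d h) else ∅

theorem linkStrategy_mem_arena {d : ℕ} {L : ℕ∞} {h : List (V × Finset V)} {v w : V}
    (hw : w ∈ linkStrategy G d L h v) : w ∈ arena G d h := by
  classical
  unfold linkStrategy at hw
  split_ifs at hw
  · exact (Finset.mem_filter.1 hw).2
  · simp at hw

theorem length_history (τ : List (V × Finset V) → V → Finset V) (c : ℕ → V) (i : ℕ) :
    (history τ c i).length = i := by
  induction i with
  | zero => rfl
  | succ i ih => simp [history, ih]

theorem mem_arena_cons {d : ℕ} {v x : V} {W : Finset V} {h : List (V × Finset V)} :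
    x ∈ arena G d ((v, W) :: h) ↔ x ∉ W ∧ Near G (arena G d h) d v x := by
  constructor
  · rintro ⟨hW, hv, hx, hd⟩
    exact ⟨hW, (edist_induce_le_iff hv hx).1 hd⟩
  · rintro ⟨hW, hn⟩
    exact ⟨hW, hn.left_mem, hn.right_mem, (edist_induce_le_iff _ _).2 hn⟩

theorem arena_history_antitone (d : ℕ) (τ : List (V × Finset V) → V → Finset V) (c : ℕ → V) :
    Antitone fun i => arena G d (history τ c i) := by
  refine antitone_nat_of_succ_le fun i x hx => ?_
  exact (mem_arena_cons.1 hx).2.right_mem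

theorem link_subset_linkAll (d : ℕ) (τ : List (V × Finset V) → V → Finset V) (c : ℕ → V)
    {i j : ℕ} (hij : i < j) (v : V) :
    link G (arena G d (history τ c i)) d (c i) v ⊆ linkAll G d (history τ c j) v := by
  classical
  induction j, hij using Nat.le_induction with
  | base =>
    rw [history, linkAll]
    exact Finset.subset_union_right
  | succ j _ ih =>
    rw [history, linkAll]
    exact ih.trans Finset.subset_union_left

/-- If connector survives against the linking strategy, then his vertices are distinct and
linked by short walks which are disjoint for consecutive pairs. -/
theorem exists_links_of_play {d : ℕ} {L : ℕ∞} {c : ℕ → V}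
    (hc : ∀ i : ℕ, (i : ℕ∞) < L → c i ∈ arena G d (history (linkStrategy G d L) c i)) :
    ∃ Q : ℕ → ℕ → Set V,
      (∀ i j : ℕ, i < j → (j : ℕ∞) < L → Near G (Q i j) d (c i) (c j)) ∧
      (∀ i j k l : ℕ, i < j → j < k → k < l → (l : ℕ∞) < L → Disjoint (Q i j) (Q k l)) ∧
      ∀ i j : ℕ, i < j → (j : ℕ∞) < L → c i ≠ c j := by
  classical
  set τ := linkStrategy G d L with hτ
  set A : ℕ → Set V := fun i => arena G d (history τ c i) with hA
  have hanti : Antitone A := arena_history_antitone d τ c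
  -- Links ending at `c j` disappear in round `j`. Links starting at a later `c k` lie in the arena
  -- `A k`, hence are disjoint from them.
  have hdel : ∀ j : ℕ, (j : ℕ∞) < L → ∀ x ∈ linkAll G d (history τ c j) (c j), x ∉ A (j + 1) := by
    intro j hj x hx hx'
    have hxj : x ∈ A j := hanti (Nat.le_succ j) hx'
    refine (mem_arena_cons.1 hx').1 ?_
    rw [hτ, linkStrategy, if_pos (by rwa [length_history])]
    exact Finset.mem_filter.2 ⟨hx, hxj⟩
  have hlt : ∀ {i j : ℕ}, i < j → (j : ℕ∞) < L → (i : ℕ∞) < L :=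
    fun hij hj => lt_trans (by exact_mod_cast hij) hj
  refine ⟨fun i j => link G (A i) d (c i) (c j), fun i j hij hj => near_link ?_,
    fun i j k l hij hjk hkl hl => ?_, fun i j hij hj he => ?_⟩
  · exact (mem_arena_cons.1 (hanti (Nat.succ_le_of_lt hij) (hc j hj))).2
  · rw [Set.disjoint_left]
    intro x hx hx'
    have hjL := hlt hjk (hlt hkl hl)
    refine hdel j hjL x (link_subset_linkAll d τ c hij (c j) hx) ?_
    exact hanti (Nat.succ_le_of_lt hjk) (link_subset _ _ _ _ x hx')
  · refine hdel i (hlt hij hj) (c i) (mem_linkAll d _ _) ?_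
    rw [he]
    exact hanti (Nat.succ_le_of_lt hij) (hc j hj)

/-- A small set cannot separate many of the vertices chosen by connector. -/
theorem not_separated_of_links {d s : ℕ} {c : ℕ → V} {Q : ℕ → ℕ → Set V} {I : Finset ℕ}
    (hI : I.card = 2 * s + 2) {S : Set V} (hS : S.encard ≤ s)
    (hQ : ∀ i ∈ I, ∀ j ∈ I, i < j → Near G (Q i j) d (c i) (c j))
    (hdisj : ∀ i ∈ I, ∀ j ∈ I, ∀ k ∈ I, ∀ l ∈ I, i < j → j < k → k < l →
      Disjoint (Q i j) (Q k l)) :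
    ∃ i ∈ I, ∃ j ∈ I, i < j ∧ Near G Sᶜ d (c i) (c j) := by
  classical
  by_contra hcon
  push Not at hcon
  let f := I.orderEmbOfFin hI
  have hfI : ∀ a, f a ∈ I := fun a => I.orderEmbOfFin_mem hI a
  -- Pairing consecutive indices gives `s + 1` pairwise disjoint links, one of which avoids `S`.
  let lo : Fin (s + 1) → Fin (2 * s + 2) := fun a => ⟨2 * a, by omega⟩
  let hi : Fin (s + 1) → Fin (2 * s + 2) := fun a => ⟨2 * a + 1, by omega⟩
  have hlh : ∀ a, f (lo a) < f (hi a) := fun a => f.strictMono (by simp [lo, hi])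
  have hmeet : ∀ a, ∃ v, v ∈ Q (f (lo a)) (f (hi a)) ∧ v ∈ S := by
    intro a
    by_contra h
    push Not at h
    exact hcon _ (hfI _) _ (hfI _) (hlh a) ((hQ _ (hfI _) _ (hfI _) (hlh a)).mono h le_rfl)
  choose v hvQ hvS using hmeet
  have hlt : ∀ a b, a < b → v a ≠ v b := by
    intro a b hab he
    refine Set.disjoint_left.1 (hdisj _ (hfI (lo a)) _ (hfI (hi a)) _ (hfI (lo b)) _ (hfI (hi b))
      (hlh a) (f.strictMono ?_) (hlh b)) (hvQ a) (he ▸ hvQ b)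
    have : (a : ℕ) < b := hab
    simp only [lo, hi, Fin.mk_lt_mk]
    omega
  have hinj : Function.Injective v := by
    intro a b he
    by_contra hne
    rcases lt_or_gt_of_ne hne with h | h
    exacts [hlt a b h he, hlt b a h he.symm]
  have h1 : (Set.range v).encard ≤ s :=
    (Set.encard_le_encard (Set.range_subset_iff.2 hvS)).trans hS
  rw [← Set.image_univ, hinj.encard_image, Set.encard_univ, ENat.card_eq_coe_fintype_card,
    Fintype.card_fin] at h1
  have : s + 1 ≤ s := by exact_mod_cast h1
  omega

end

/-- If connector survived `ℓ` rounds, uniform quasi-wideness would scatter `2 * s d + 2` of the `ℓ`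
distinct vertices played by deleting `s d` vertices, too few to meet all the disjoint links. -/
theorem UniformlyQuasiWide.winningForSplitter {C : Set FiniteGraph.{u}} {s : ℕ → ℕ}
    (h : UniformlyQuasiWide C s) : WinningForSplitter C := by
  classical
  intro d
  obtain ⟨ℓ, hℓ⟩ := h d (2 * s d + 2)
  -- The bound counts connector's vertex and at most `ℓ` links of `d + 1` vertices each. Capping the
  -- strategy at `ℓ` rounds makes it hold for every history.
  refine ⟨ℓ, 1 + ℓ * (d + 1), fun G hG => ⟨linkStrategy G.graph d ℓ, fun h v => ⟨fun w hw =>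
    linkStrategy_mem_arena hw, ?_⟩, fun c hc => ?_⟩⟩
  · unfold linkStrategy
    split_ifs with hlt
    · refine (Finset.card_filter_le _ _).trans ((card_linkAll_le d h v).trans ?_)
      have : h.length ≤ ℓ := by exact_mod_cast hlt.le
      gcongr
    · simp
  by_contra hne
  push Not at hne
  have hc' : ∀ i : ℕ, (i : ℕ∞) < ℓ →
      c i ∈ arena G.graph d (history (linkStrategy G.graph d ℓ) c i) := by
    intro i hi
    have hi' : i < ℓ := by exact_mod_cast hi
    exact hc i hi' (hne i hi'.le)
  obtain ⟨Q, hQ, hdisj, hinj⟩ := exists_links_of_play hc'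
  have hinj' : Set.InjOn c (Set.Iio ℓ) := by
    intro i hi j hj he
    by_contra hij
    rcases lt_or_gt_of_ne hij with h | h
    · exact hinj i j h (by exact_mod_cast hj) he
    · exact hinj j i h (by exact_mod_cast hi) he.symm
  obtain ⟨S, hS, X, hX, hXm, hXW⟩ := hℓ G hG (c '' Set.Iio ℓ) (by
    rw [hinj'.encard_image, Set.encard_eq_coe_toFinset_card]
    simp)
  rw [isScatteredIn_iff] at hX
  set I : Finset ℕ := (Finset.range ℓ).filter fun i => c i ∈ Subtype.val '' X with hI
  have hIℓ : ∀ i ∈ I, i < ℓ := fun i hi => Finset.mem_range.1 (Finset.mem_filter.1 hi).1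
  have hIX : c '' (I : Set ℕ) = Subtype.val '' X := by
    ext v
    constructor
    · rintro ⟨i, hi, rfl⟩
      exact (Finset.mem_filter.1 hi).2
    · rintro ⟨x, hx, rfl⟩
      obtain ⟨i, hi, hix⟩ := hXW x hx
      exact ⟨i, Finset.mem_filter.2 ⟨Finset.mem_range.2 hi, hix ▸ ⟨x, hx, rfl⟩⟩, hix⟩
  have hIcard : I.card = 2 * s d + 2 := by
    have h1 : (c '' (I : Set ℕ)).encard = (2 * s d + 2 : ℕ) := by
      rw [hIX, Subtype.val_injective.encard_image, hXm]
    rw [Set.InjOn.encard_image (hinj'.mono fun i hi => hIℓ i hi),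
      Set.encard_coe_eq_coe_finsetCard] at h1
    exact_mod_cast h1
  obtain ⟨i, hi, j, hj, hij, hn⟩ := not_separated_of_links (G := G.graph) (d := d) hIcard hS
    (fun i hi j hj hij => hQ i j hij (by exact_mod_cast hIℓ j hj))
    (fun i _ j _ k _ l hl hij hjk hkl => hdisj i j k l hij hjk hkl (by exact_mod_cast hIℓ l hl))
  obtain ⟨x, hx, hxi⟩ := (Finset.mem_filter.1 hi).2
  obtain ⟨y, hy, hyj⟩ := (Finset.mem_filter.1 hj).2
  refine hX x hx y hy (fun h => ?_) ?_
  · exact hinj i j hij (by exact_mod_cast hIℓ j hj) (by rw [← hxi, ← hyj, h])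
  · rw [hxi, hyj]
    exact hn.mono subset_rfl (by omega)

theorem UniformlyLimitQuasiWide.limitWinningForSplitter {U : Ultrafilter ℕ}
    {C : Set FiniteGraph.{u}} (h : UniformlyLimitQuasiWide U C) :
    LimitWinningForSplitter U C := by
  classical
  intro d V G hG
  refine ⟨linkStrategy G d ⊤, fun h v w hw => linkStrategy_mem_arena hw, fun c hc => ?_⟩
  by_contra hne
  push Not at hne
  obtain ⟨Q, hQ, hdisj, hinj⟩ := exists_links_of_play (L := ⊤) fun i _ => hc i (hne i)
  have htop : ∀ i : ℕ, (i : ℕ∞) < ⊤ := fun i => ENat.natCast_lt_top i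
  have hinj' : Function.Injective c := by
    intro i j he
    by_contra hij
    rcases lt_or_gt_of_ne hij with h | h
    · exact hinj i j h (htop j) he
    · exact hinj j i h (htop i) he.symm
  obtain ⟨S, hS, X, hX, hXinf, hXW⟩ := h d V G hG (Set.range c)
    (Set.infinite_range_of_injective hinj')
  rw [isScatteredIn_iff] at hX
  have hJ : (c ⁻¹' (Subtype.val '' X)).Infinite := by
    refine (hXinf.image Subtype.val_injective.injOn).preimage ?_
    rintro _ ⟨x, hx, rfl⟩
    exact hXW x hx
  -- The size of `S` is known only now, which is why an infinite scattered set is needed.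
  obtain ⟨I, hIJ, hIcard⟩ := hJ.exists_subset_card_eq (2 * S.ncard + 2)
  obtain ⟨i, hi, j, hj, hij, hn⟩ := not_separated_of_links (G := G) (d := d) hIcard
    hS.cast_ncard_eq.ge
    (fun i _ j _ hij => hQ i j hij (htop j))
    (fun i _ j _ k _ l _ hij hjk hkl => hdisj i j k l hij hjk hkl (htop l))
  obtain ⟨x, hx, hxi⟩ := hIJ hi
  obtain ⟨y, hy, hyj⟩ := hIJ hj
  refine hX x hx y hy (fun h => ?_) ?_
  · exact hinj i j hij (htop j) (by rw [← hxi, ← hyj, h])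
  · rw [hxi, hyj]
    exact hn.mono subset_rfl (by omega)

/-! ### Subdivided cliques after the deletion of few vertices -/

section

variable {V : Type u} {G : SimpleGraph V} {ι : Type v} {D : ℕ} {α : ι → V}
  {P : ∀ i j, (SimpleGraph.completeGraph ι).Adj i j → G.Walk (α i) (α j)}

namespace IsSubdivision

variable {S T : Set V} {s : ℕ}

/-- Paths leaving a branch vertex outside `S` share no other vertex, so each element of `S` blocks
at most one of them. -/
theorem encard_hit_le
    (hP : IsSubdivision D (SimpleGraph.completeGraph ι) G α P)
    (hS : S.encard ≤ s) {i : ι} (hi : α i ∉ S) :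
    {z | ∃ h, ∃ x ∈ (P i z h).support, x ∈ S}.encard ≤ s := by
  classical
  have key : ∀ z, ∃ x, z ∈ {z | ∃ h, ∃ x ∈ (P i z h).support, x ∈ S} →
      ∃ h, x ∈ (P i z h).support ∧ x ∈ S := by
    intro z
    by_cases hz : z ∈ {z | ∃ h, ∃ x ∈ (P i z h).support, x ∈ S}
    · obtain ⟨h, x, hx, hxS⟩ := hz
      exact ⟨x, fun _ => ⟨h, hx, hxS⟩⟩
    · exact ⟨α i, fun h => absurd h hz⟩
  choose f hf using key
  refine (Set.encard_le_encard_of_injOn (t := S) (f := f) (fun z hz => ?_) ?_).trans hS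
  · obtain ⟨_, _, h⟩ := hf z hz
    exact h
  · intro z hz z' hz' he
    obtain ⟨h, hx, hxS⟩ := hf z hz
    obtain ⟨h', hx', -⟩ := hf z' hz'
    by_contra hne
    have h1 := hP.inter i z h i z' h' (by
      rw [Ne, Sym2.eq_iff]
      rintro (⟨-, h⟩ | ⟨h, -⟩)
      exacts [hne h, h'.ne h]) (f z) hx (he ▸ hx')
    have hne1 : f z ≠ α i := fun h => hi (h ▸ hxS)
    exact hne (hP.injective ((h1.1.resolve_left hne1).symm.trans (h1.2.resolve_left hne1)))

/-- At most `s` ends are blocked from `i` and at most `s` from `j`; with `i` and `j` themselves this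
excludes at most `2 * s + 2` indices. -/
theorem exists_common_hub
    (hP : IsSubdivision D (SimpleGraph.completeGraph ι) G α P)
    (hS : S.encard ≤ s) (hι : ((2 * s + 3 : ℕ) : ℕ∞) ≤ ENat.card ι)
    {i j : ι} (hi : α i ∉ S) (hj : α j ∉ S) :
    ∃ z h h', (∀ x ∈ (P i z h).support, x ∉ S) ∧ ∀ x ∈ (P j z h').support, x ∉ S := by
  by_contra hcon
  have hsub : (Set.univ : Set ι) ⊆ {z | ∃ h, ∃ x ∈ (P i z h).support, x ∈ S} ∪
      {z | ∃ h, ∃ x ∈ (P j z h).support, x ∈ S} ∪ {i, j} := by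
    intro z _
    by_contra hz
    simp only [Set.mem_union, Set.mem_ofPred_eq, Set.mem_insert_iff, Set.mem_singleton_iff,
      not_or, not_exists, not_and] at hz
    obtain ⟨⟨h1, h2⟩, h3, h4⟩ := hz
    exact hcon ⟨z, Ne.symm h3, Ne.symm h4, h1 _, h2 _⟩
  have h1 := Set.encard_le_encard hsub
  rw [Set.encard_univ] at h1
  have h2 : ((2 * s + 3 : ℕ) : ℕ∞) ≤ ((s + s + 2 : ℕ) : ℕ∞) := by
    refine (hι.trans h1).trans ((Set.encard_union_le _ _).trans ?_)
    rw [Nat.cast_add, Nat.cast_add]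
    gcongr
    · refine (Set.encard_union_le _ _).trans ?_
      gcongr
      exacts [hP.encard_hit_le hS hi, hP.encard_hit_le hS hj]
    · exact (Set.encard_insert_le _ _).trans (by rw [Set.encard_singleton]; exact le_rfl)
  have : 2 * s + 3 ≤ s + s + 2 := by exact_mod_cast h2
  omega

/-- Surviving branch vertices are joined through a third one by two unblocked paths. The set `T` is
kept general to cover both the complement of `S` and the arena of a game. -/
theorem near_of_notMem
    (hP : IsSubdivision D (SimpleGraph.completeGraph ι) G α P)
    (hS : S.encard ≤ s) (hι : ((2 * s + 3 : ℕ) : ℕ∞) ≤ ENat.card ι)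
    (hT : ∀ i j h, (∀ x ∈ (P i j h).support, x ∉ S) → ∀ x ∈ (P i j h).support, x ∈ T)
    {i j : ι} (hi : α i ∉ S) (hj : α j ∉ S) : Near G T (4 * D + 2) (α i) (α j) := by
  obtain ⟨z, h, h', hz, hz'⟩ := hP.exists_common_hub hS hι hi hj
  have n1 : Near G T (2 * D + 1) (α i) (α z) :=
    ⟨P i z h, (hP.path i z h).2, hT _ _ _ hz⟩
  have n2 : Near G T (2 * D + 1) (α j) (α z) :=
    ⟨P j z h', (hP.path j z h').2, hT _ _ _ hz'⟩
  exact (n1.trans n2.symm).mono subset_rfl (by omega)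

theorem exists_notMem
    (hP : IsSubdivision D (SimpleGraph.completeGraph ι) G α P)
    (hS : S.encard ≤ s) (hι : ((2 * s + 3 : ℕ) : ℕ∞) ≤ ENat.card ι) :
    ∃ i, α i ∉ S := by
  by_contra hcon
  push Not at hcon
  have h1 : (Set.range α).encard ≤ s :=
    (Set.encard_le_encard (Set.range_subset_iff.2 hcon)).trans hS
  rw [← Set.image_univ, hP.injective.encard_image, Set.encard_univ] at h1
  have : 2 * s + 3 ≤ s := by exact_mod_cast hι.trans h1
  omega

end IsSubdivision

/-! ### Connector's strategy -/

/-- The arena contains all paths of the subdivision that avoid `S`. -/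
def ContainsPaths (D : ℕ)
    (P : ∀ i j, (SimpleGraph.completeGraph ι).Adj i j → G.Walk (α i) (α j)) (S : Set V)
    (h : List (V × Finset V)) : Prop :=
  ∀ i j hij, (∀ x ∈ (P i j hij).support, x ∉ S) →
    ∀ x ∈ (P i j hij).support, x ∈ arena G (6 * D + 3) h

namespace IsSubdivision

variable {S T : Set V} {s : ℕ}

/-- Connector plays any surviving branch vertex. The start of every unblocked path is within `4 * D
+ 2` of it and the rest of the path within a further `2 * D + 1`, so the radius `6 * D + 3`
preserves the invariant. -/
theorem exists_connector_move
    (hP : IsSubdivision D (SimpleGraph.completeGraph ι) G α P)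
    (hS : S.encard ≤ s)
    (hι : ((2 * s + 3 : ℕ) : ℕ∞) ≤ ENat.card ι) {h : List (V × Finset V)}
    (hinv : ContainsPaths D P S h) :
    ∃ v ∈ arena G (6 * D + 3) h, ∀ W : Finset V,
      ContainsPaths D P (S ∪ W) ((v, W) :: h) := by
  classical
  obtain ⟨i, hi⟩ := hP.exists_notMem hS hι
  refine ⟨α i, (hP.near_of_notMem hS hι hinv hi hi).left_mem, fun W a b hab hav x hx => ?_⟩
  have havS : ∀ y ∈ (P a b hab).support, y ∉ S := fun y hy h => hav y hy (.inl h)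
  refine mem_arena_cons.2 ⟨fun h => hav x hx (.inr h), ?_⟩
  have n1 := hP.near_of_notMem hS hι hinv hi (havS _ (SimpleGraph.Walk.start_mem_support _))
  have n2 : Near G (arena G (6 * D + 3) h) (2 * D + 1) (α a) x := by
    refine ⟨(P a b hab).takeUntil x hx,
      ((P a b hab).length_takeUntil_le_length hx).trans (hP.path a b hab).2, fun y hy => ?_⟩
    exact hinv a b hab havS y ((P a b hab).support_takeUntil_subset_support hx hy)
  exact (n1.trans n2).mono subset_rfl (by omega)

end IsSubdivision

/-- If connector can always move so as to preserve an invariant of the history, then he can do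
so throughout a play. -/
theorem exists_play [Nonempty V] (τ : List (V × Finset V) → V → Finset V)
    (Good : ℕ → List (V × Finset V) → Prop) (Legal : ℕ → List (V × Finset V) → V → Prop)
    (h0 : Good 0 [])
    (hstep : ∀ k h, Good k h → ∃ v, Legal k h v ∧ Good (k + 1) ((v, τ h v) :: h)) :
    ∃ c : ℕ → V, ∀ k, Good k (history τ c k) ∧ Legal k (history τ c k) (c k) := by
  classical
  have hpick : ∀ k h, ∃ v, Good k h → Legal k h v ∧ Good (k + 1) ((v, τ h v) :: h) := by
    intro k h
    by_cases hg : Good k h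
    · obtain ⟨v, hv⟩ := hstep k h hg
      exact ⟨v, fun _ => hv⟩
    · exact ⟨Classical.arbitrary V, fun h => absurd h hg⟩
  choose pick hpick using hpick
  let H : ℕ → List (V × Finset V) := fun n =>
    Nat.rec [] (fun k h => (pick k h, τ h (pick k h)) :: h) n
  let c : ℕ → V := fun k => pick k (H k)
  have hH : ∀ k, history τ c k = H k := by
    intro k
    induction k with
    | zero => rfl
    | succ k ih =>
      rw [history, ih]
  have hgood : ∀ k, Good k (H k) := by
    intro k
    induction k with
    | zero => exact h0
    | succ k ih => exact (hpick k _ ih).2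
  exact ⟨c, fun k => by rw [hH]; exact ⟨hgood k, (hpick k _ (hgood k)).1⟩⟩

/-- Splitter deletes at most `ℓ * m` vertices in `ℓ` rounds, and a clique with `2 * (ℓ * m) + 3`
branch vertices leaves connector a move even after the last of them. -/
theorem not_splitterWins_of_isTopShallowMinor {ℓ m : ℕ}
    (h : IsTopShallowMinor D (SimpleGraph.completeGraph (Fin (2 * (ℓ * m) + 3))) G) :
    ¬ SplitterWins G ℓ m (6 * D + 3) := by
  classical
  rintro ⟨τ, hτ, hwin⟩
  obtain ⟨α, P, hP⟩ := isTopShallowMinor_iff.1 h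
  have : Nonempty V := ⟨α ⟨0, by omega⟩⟩
  have hcard : ((2 * (ℓ * m) + 3 : ℕ) : ℕ∞) ≤ ENat.card (Fin (2 * (ℓ * m) + 3)) := by simp
  have hle : ∀ {k} {S : Set V}, k ≤ ℓ → S.encard ≤ (k * m : ℕ) → S.encard ≤ (ℓ * m : ℕ) := by
    intro k S hk hS
    exact hS.trans (by exact_mod_cast Nat.mul_le_mul_right m hk)
  obtain ⟨c, hc⟩ := exists_play τ
    (fun k h => k ≤ ℓ → ∃ S : Set V, S.encard ≤ (k * m : ℕ) ∧ ContainsPaths D P S h)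
    (fun k h v => k < ℓ → v ∈ arena G (6 * D + 3) h)
    (fun _ => ⟨∅, by simp, fun _ _ _ _ x _ => Set.mem_univ x⟩)
    (by
      intro k h hk
      by_cases hkl : k < ℓ
      · obtain ⟨S, hS, hinv⟩ := hk hkl.le
        obtain ⟨v, hv, hW⟩ := hP.exists_connector_move (hle hkl.le hS) hcard hinv
        refine ⟨v, fun _ => hv, fun _ => ⟨S ∪ τ h v, ?_, hW _⟩⟩
        refine (Set.encard_union_le _ _).trans ?_
        rw [Nat.add_mul, one_mul, Nat.cast_add, Set.encard_coe_eq_coe_finsetCard]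
        gcongr
        exact (hτ h v).2
      · exact ⟨Classical.arbitrary V, fun h => absurd h hkl, fun h => absurd h (by omega)⟩)
  obtain ⟨i, hi, hempty⟩ := hwin c fun i hi _ => (hc i).2 hi
  obtain ⟨S, hS, hinv⟩ := (hc i).1 hi
  obtain ⟨v, hv, -⟩ := hP.exists_connector_move (hle hi hS) hcard hinv
  rw [hempty] at hv
  exact hv

theorem not_splitterWinsLimit_of_isTopShallowMinor
    (h : IsTopShallowMinor D (SimpleGraph.completeGraph ℕ) G) :
    ¬ SplitterWinsLimit G (6 * D + 3) := by
  classical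
  rintro ⟨τ, hτ, hwin⟩
  obtain ⟨α, P, hP⟩ := isTopShallowMinor_iff.1 h
  have : Nonempty V := ⟨α 0⟩
  have hmove : ∀ {S : Set V} {h : List (V × Finset V)}, S.Finite → ContainsPaths D P S h →
      ∃ v ∈ arena G (6 * D + 3) h, ∀ W : Finset V,
        ContainsPaths D P (S ∪ W) ((v, W) :: h) :=
    fun hS hinv => hP.exists_connector_move hS.cast_ncard_eq.ge (by simp) hinv
  obtain ⟨c, hc⟩ := exists_play τ
    (fun _ h => ∃ S : Set V, S.Finite ∧ ContainsPaths D P S h)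
    (fun _ h v => v ∈ arena G (6 * D + 3) h)
    ⟨∅, Set.finite_empty, fun _ _ _ _ x _ => Set.mem_univ x⟩
    (by
      rintro k h ⟨S, hS, hinv⟩
      obtain ⟨v, hv, hW⟩ := hmove hS hinv
      exact ⟨v, hv, S ∪ τ h v, hS.union (Finset.finite_toSet _), hW _⟩)
  obtain ⟨i, hempty⟩ := hwin c fun i _ => (hc i).2
  have hv := (hc i).2
  rw [hempty] at hv
  exact hv

/-! ### Scattered sets in subdivided cliques -/

namespace IsSubdivision

variable {S : Set V} {s : ℕ}

/-- Two distinct vertices determine the path of the subdivision that contains both. -/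
theorem exists_finset_of_ne
    (hP : IsSubdivision D (SimpleGraph.completeGraph ι) G α P)
    {a b : V} (hab : a ≠ b) : ∃ F : Finset V, F.card ≤ 4 * D + 4 ∧
    ∀ i j h, a ∈ (P i j h).support → b ∈ (P i j h).support →
      ∀ x ∈ (P i j h).support, x ∈ F := by
  classical
  by_cases hex : ∃ i j h, a ∈ (P i j h).support ∧ b ∈ (P i j h).support
  swap
  · exact ⟨∅, by simp, fun i j h ha hb => absurd ⟨i, j, h, ha, hb⟩ hex⟩
  obtain ⟨i, j, h, ha, hb⟩ := hex
  -- The paths for the two orientations of an edge are unrelated, so both are included; each has at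
  -- most `2 * D + 2` vertices.
  refine ⟨(P i j h).support.toFinset ∪ (P j i h.symm).support.toFinset, ?_, ?_⟩
  · have hc : ∀ i j h, (P i j h).support.toFinset.card ≤ 2 * D + 2 := fun i j h => by
      refine (List.toFinset_card_le _).trans ?_
      rw [SimpleGraph.Walk.length_support]
      have := (hP.path i j h).2
      omega
    refine (Finset.card_union_le _ _).trans ?_
    have := hc i j h
    have := hc j i h.symm
    omega
  · intro i' j' h' ha' hb' x hx
    have he : s(i, j) = s(i', j') := by
      by_contra hne
      have h1 := hP.inter i j h i' j' h' hne a ha ha'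
      have h2 := hP.inter i j h i' j' h' hne b hb hb'
      have hinj := hP.injective
      apply hne
      rw [Sym2.eq_iff]
      rcases h1 with ⟨h1 | h1, h1' | h1'⟩ <;> rcases h2 with ⟨h2 | h2, h2' | h2'⟩ <;>
        first
        | exact absurd (h1.trans h2.symm) hab
        | exact absurd (h1'.trans h2'.symm) hab
        | exact .inl ⟨hinj (h1.symm.trans h1'), hinj (h2.symm.trans h2')⟩
        | exact .inl ⟨hinj (h2.symm.trans h2'), hinj (h1.symm.trans h1')⟩
        | exact .inr ⟨hinj (h1.symm.trans h1'), hinj (h2.symm.trans h2')⟩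
        | exact .inr ⟨hinj (h2.symm.trans h2'), hinj (h1.symm.trans h1')⟩
    rcases Sym2.eq_iff.1 he with ⟨rfl, rfl⟩ | ⟨rfl, rfl⟩
    · exact Finset.mem_union_left _ (List.mem_toFinset.2 hx)
    · exact Finset.mem_union_right _ (List.mem_toFinset.2 hx)

/-- All but few vertices of the subdivision remain near some branch vertex. -/
theorem exists_finset_not_near
    (hP : IsSubdivision D (SimpleGraph.completeGraph ι) G α P)
    (hcover : ∀ v, ∃ i j h, v ∈ (P i j h).support)
    (hS : S.encard ≤ s) : ∃ F : Finset V, F.card ≤ s * s * (4 * D + 4) ∧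
      ∀ x ∉ S, x ∉ F → ∃ i, Near G Sᶜ (2 * D + 1) (α i) x := by
  classical
  have hfin : S.Finite := Set.finite_of_encard_le_coe hS
  have hScard : hfin.toFinset.card ≤ s := by
    rw [hfin.encard_eq_coe_toFinset_card] at hS
    exact_mod_cast hS
  have key : ∀ q : V × V, ∃ F : Finset V, F.card ≤ 4 * D + 4 ∧ (q.1 ≠ q.2 →
      ∀ i j h, q.1 ∈ (P i j h).support → q.2 ∈ (P i j h).support →
        ∀ x ∈ (P i j h).support, x ∈ F) := by
    intro q
    by_cases hq : q.1 = q.2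
    · exact ⟨∅, by simp, fun h => absurd hq h⟩
    · obtain ⟨F, hF, h⟩ := hP.exists_finset_of_ne hq
      exact ⟨F, hF, fun _ => h⟩
  choose F hF hFP using key
  refine ⟨(hfin.toFinset ×ˢ hfin.toFinset).biUnion F, ?_, fun x hxS hxF => ?_⟩
  · refine (Finset.card_biUnion_le_card_mul _ _ _ fun q _ => hF q).trans ?_
    rw [Finset.card_product]
    gcongr
  · by_contra hcon
    push Not at hcon
    obtain ⟨i, j, h, hx⟩ := hcover x
    have hlen := (hP.path i j h).2
    -- A vertex cut off from both ends of its path has elements `a` and `b` of `S` on either side.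
    -- They are distinct, so the pair determines the edge of the path, and `x` is among the vertices
    -- counted for one of at most `s * s` pairs.
    obtain ⟨a, ha, haS⟩ : ∃ a ∈ ((P i j h).takeUntil x hx).support, a ∈ S := by
      by_contra hno
      push Not at hno
      exact hcon i ⟨(P i j h).takeUntil x hx,
        ((P i j h).length_takeUntil_le_length hx).trans hlen, hno⟩
    obtain ⟨b, hb, hbS⟩ : ∃ b ∈ ((P i j h).dropUntil x hx).support, b ∈ S := by
      by_contra hno
      push Not at hno
      have hn : Near G Sᶜ (2 * D + 1) x (α j) := ⟨(P i j h).dropUntil x hx,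
        ((P i j h).length_dropUntil_le_length hx).trans hlen, hno⟩
      exact hcon j hn.symm
    have hab : a ≠ b := by
      rintro rfl
      have hnd := (hP.path i j h).1.support_nodup
      rw [← (P i j h).take_spec hx, SimpleGraph.Walk.support_append, List.nodup_append] at hnd
      rw [← SimpleGraph.Walk.cons_tail_support, List.mem_cons] at hb
      rcases hb with rfl | hb
      · exact hxS haS
      · exact hnd.2.2 a ha a hb rfl
    refine hxF (Finset.mem_biUnion.2 ⟨(a, b), ?_, hFP (a, b) hab i j h ?_ ?_ x hx⟩)
    · simp [haS, hbS]
    · exact (P i j h).support_takeUntil_subset_support hx ha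
    · exact (P i j h).support_dropUntil_subset_support hx hb

/-- Outside a small exceptional set, any two surviving vertices are within `(2 * D + 1) + (4 * D +
2) + (2 * D + 1) = 2 * (4 * D + 2)`, so a scattered set has at most one element there. -/
theorem encard_scattered_le
    (hP : IsSubdivision D (SimpleGraph.completeGraph ι) G α P)
    (hcover : ∀ v, ∃ i j h, v ∈ (P i j h).support)
    (hS : S.encard ≤ s) (hι : ((2 * s + 3 : ℕ) : ℕ∞) ≤ ENat.card ι)
    {X : Set (Sᶜ : Set V)} (hX : IsScatteredIn G S (4 * D + 2) X) :
    X.encard ≤ (s * s * (4 * D + 4) + 1 : ℕ) := by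
  classical
  rw [isScatteredIn_iff] at hX
  obtain ⟨F, hF, hnear⟩ := hP.exists_finset_not_near hcover hS
  set Y : Set V := Subtype.val '' X with hY
  have hsub : (Y \ F).Subsingleton := by
    rintro _ ⟨⟨x, hx, rfl⟩, hxF⟩ _ ⟨⟨y, hy, rfl⟩, hyF⟩
    by_contra hne
    refine hX x hx y hy (fun h => hne (h ▸ rfl)) ?_
    obtain ⟨i, hi⟩ := hnear x x.2 hxF
    obtain ⟨j, hj⟩ := hnear y y.2 hyF
    have hij := hP.near_of_notMem (T := Sᶜ) hS hι (fun _ _ _ h => h) hi.left_mem hj.left_mem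
    exact ((hi.symm.trans hij).trans hj).mono subset_rfl (by omega)
  rw [← Subtype.val_injective.encard_image X]
  calc Y.encard ≤ ((F : Set V) ∪ (Y \ F)).encard :=
        Set.encard_le_encard (by rw [Set.union_sdiff_self]; exact Set.subset_union_right)
    _ ≤ (F : Set V).encard + (Y \ F).encard := Set.encard_union_le _ _
    _ ≤ (s * s * (4 * D + 4) : ℕ) + (1 : ℕ) := by
        rw [Set.encard_coe_eq_coe_finsetCard]
        gcongr
        exact_mod_cast Set.encard_le_one_iff_subsingleton.2 hsub
    _ = _ := by push_cast; rfl

end IsSubdivision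

/-- The subgraph induced by the vertices of a subdivided clique is covered by its paths. -/
theorem IsTopShallowMinor.exists_cover [Nontrivial ι]
    (h : IsTopShallowMinor D (SimpleGraph.completeGraph ι) G) :
    ∃ (s : Set V) (α : ι → s)
      (P : ∀ i j, (SimpleGraph.completeGraph ι).Adj i j → (G.induce s).Walk (α i) (α j)),
      IsSubdivision D (SimpleGraph.completeGraph ι) (G.induce s) α P ∧
        ∀ v, ∃ i j h, v ∈ (P i j h).support := by
  obtain ⟨α, P, hP⟩ := isTopShallowMinor_iff.1 h
  have hα : ∀ i, α i ∈ {x | ∃ i j h, x ∈ (P i j h).support} := fun i => by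
    obtain ⟨j, hj⟩ := exists_ne i
    exact ⟨i, j, hj.symm, SimpleGraph.Walk.start_mem_support _⟩
  refine ⟨{x | ∃ i j h, x ∈ (P i j h).support}, _, _,
    hP.induce hα (fun i j h x hx => ⟨i, j, h, hx⟩), ?_⟩
  rintro ⟨v, i, j, h, hv⟩
  exact ⟨i, j, h, (mem_support_induce _).2 hv⟩

end

/-! ### Converse implications -/

theorem WinningForSplitter.topNowhereDense {C : Set FiniteGraph.{u}}
    (h : WinningForSplitter C) : TopNowhereDense C := by
  rintro ⟨D, hD⟩
  obtain ⟨ℓ, m, hwin⟩ := h (6 * D + 3)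
  obtain ⟨G, hG, hm⟩ := hD (finiteClique (2 * (ℓ * m) + 3))
  obtain ⟨f⟩ := exists_copy_completeGraph_of_injective
    (ULift.up_injective (α := Fin (2 * (ℓ * m) + 3)))
  exact not_splitterWins_of_isTopShallowMinor (hm.mono_left f) (hwin G hG)

theorem LimitWinningForSplitter.limitTopNowhereDense {U : Ultrafilter ℕ}
    {C : Set FiniteGraph.{u}} (h : LimitWinningForSplitter U C) : LimitTopNowhereDense U C := by
  rintro ⟨D, V, G, hG, hm⟩
  exact not_splitterWinsLimit_of_isTopShallowMinor hm (h _ V G hG)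

/-- Without uniformity the scattered set could lie away from the subdivided clique. Since the class
limit is closed under subgraphs, the argument is applied to the subgraph induced by the subdivision.
-/
theorem LimitQuasiWide.limitTopNowhereDense {U : Ultrafilter ℕ} {C : Set FiniteGraph.{u}}
    (h : LimitQuasiWide U C) : LimitTopNowhereDense U C := by
  rintro ⟨D, V, G, ⟨F, hF, hc⟩, hm⟩
  obtain ⟨s, α, P, hP, hcover⟩ := hm.exists_cover
  obtain ⟨S, hS, X, hX, hinf⟩ := h (4 * D + 2) s (G.induce s)
    ⟨F, hF, .trans ⟨(SimpleGraph.Embedding.induce s).toCopy⟩ hc⟩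
    (Infinite.of_injective α hP.injective)
  have := hP.encard_scattered_le hcover hS.cast_ncard_eq.ge (by simp) hX
  rw [hinf.encard_eq] at this
  exact ENat.natCast_ne_top _ (top_le_iff.1 this)

/-- Heredity allows the restriction to the vertices of a subdivided clique, which the class limit
permits for free. -/
theorem QuasiWide.topNowhereDense {C : Set FiniteGraph.{u}} (hC : Hereditary C) {s : ℕ → ℕ}
    (h : QuasiWide C s) : TopNowhereDense C := by
  rintro ⟨D, hD⟩
  set b := s (4 * D + 2) with hb
  -- The requested size is one more than `encard_scattered_le` allows. The clique size `t` below
  -- makes the graph have at least `N` vertices and leaves enough branch vertices after deleting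
  -- `b`.
  obtain ⟨N, hN⟩ := h (4 * D + 2) (b * b * (4 * D + 4) + 2)
  set t := N + (2 * b + 3) with ht
  obtain ⟨G, hG, hm⟩ := hD (finiteClique t)
  obtain ⟨f⟩ := exists_copy_completeGraph_of_injective (ULift.up_injective (α := Fin t))
  have : Nontrivial (Fin t) := Fin.nontrivial_iff_two_le.2 (by omega)
  obtain ⟨A, α, P, hP, hcover⟩ := (hm.mono_left f).exists_cover
  obtain ⟨H, hH, ⟨e⟩⟩ := hC G hG A
  have hP' := hP.map e.symm.toHom e.symm.injective
  have hfin := H.finite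
  have hcard : N ≤ Nat.card H.V := by
    have := Nat.card_le_card_of_injective _ hP'.injective
    rw [Nat.card_fin] at this
    omega
  obtain ⟨S, hS, X, hX, hXm⟩ := hN H hH hcard
  have h1 := hP'.encard_scattered_le (fun v => by
    obtain ⟨i, j, hij, hv⟩ := hcover (e v)
    refine ⟨i, j, hij, ?_⟩
    rw [SimpleGraph.Walk.support_map]
    exact List.mem_map.2 ⟨e v, hv, e.symm_apply_apply v⟩) hS
    (by rw [ENat.card_eq_coe_fintype_card, Fintype.card_fin]; exact_mod_cast Nat.le_add_left _ _)
    hX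
  rw [hXm] at h1
  have : b * b * (4 * D + 4) + 2 ≤ b * b * (4 * D + 4) + 1 := by exact_mod_cast h1
  omega

/-! ### Immediate implications -/

section

variable {U : Ultrafilter ℕ} {C : Set FiniteGraph.{u}} {s : ℕ → ℕ}

theorem StronglyUniformlyLimitQuasiWide.stronglyLimitQuasiWide
    (h : StronglyUniformlyLimitQuasiWide U C s) : StronglyLimitQuasiWide U C s := by
  intro d V G hG hV
  obtain ⟨S, hS, X, hX, hinf, -⟩ := h d V G hG Set.univ Set.infinite_univ
  exact ⟨S, hS, X, hX, hinf⟩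

theorem StronglyLimitQuasiWide.limitQuasiWide (h : StronglyLimitQuasiWide U C s) :
    LimitQuasiWide U C := by
  intro d V G hG hV
  obtain ⟨S, hS, X⟩ := h d V G hG hV
  exact ⟨S, Set.finite_of_encard_le_coe hS, X⟩

theorem StronglyUniformlyLimitQuasiWide.uniformlyLimitQuasiWide
    (h : StronglyUniformlyLimitQuasiWide U C s) : UniformlyLimitQuasiWide U C := by
  intro d V G hG W hW
  obtain ⟨S, hS, X⟩ := h d V G hG W hW
  exact ⟨S, Set.finite_of_encard_le_coe hS, X⟩

theorem UniformlyQuasiWide.quasiWide (h : UniformlyQuasiWide C s) : QuasiWide C s := by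
  intro d m
  obtain ⟨N, hN⟩ := h d m
  refine ⟨N, fun G hG hcard => ?_⟩
  have := G.finite
  obtain ⟨S, hS, X, hX, hm, -⟩ := hN G hG Set.univ (by
    rw [Set.encard_univ, ENat.card_eq_coe_natCard]
    exact_mod_cast hcard)
  exact ⟨S, hS, X, hX, hm⟩

end

end GraphClass

/-! ### Assembly of the equivalences -/

theorem mainTheorem1 (U : Ultrafilter ℕ) (hU : ∀ n : ℕ, {n} ∉ U)
    (C : Set FiniteGraph.{u}) :
    List.TFAE [
      GraphClass.NowhereDense C,
      GraphClass.TopNowhereDense C,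
      GraphClass.LimitNowhereDense U C,
      GraphClass.LimitTopNowhereDense U C,
      ∃ s : ℕ → ℕ, GraphClass.StronglyLimitQuasiWide U C s,
      ∃ s : ℕ → ℕ, GraphClass.StronglyUniformlyLimitQuasiWide U C s,
      GraphClass.LimitQuasiWide U C,
      GraphClass.UniformlyLimitQuasiWide U C,
      GraphClass.WinningForSplitter C,
      GraphClass.LimitWinningForSplitter U C] ∧
    (GraphClass.Hereditary C →
      List.TFAE [
        GraphClass.NowhereDense C,
        ∃ s : ℕ → ℕ, GraphClass.QuasiWide C s,
        ∃ s : ℕ → ℕ, GraphClass.UniformlyQuasiWide C s]) := by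
  have h12 : GraphClass.NowhereDense C → GraphClass.TopNowhereDense C :=
    mt GraphClass.TopSomewhereDense.somewhereDense
  have h24 : GraphClass.TopNowhereDense C → GraphClass.LimitTopNowhereDense U C :=
    mt GraphClass.LimitTopSomewhereDense.topSomewhereDense
  have h43 : GraphClass.LimitTopNowhereDense U C → GraphClass.LimitNowhereDense U C :=
    mt GraphClass.LimitSomewhereDense.limitTopSomewhereDense
  have h31 : GraphClass.LimitNowhereDense U C → GraphClass.NowhereDense C :=
    mt (GraphClass.SomewhereDense.limitSomewhereDense hU)
  have h26 : GraphClass.TopNowhereDense C →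
      ∃ s : ℕ → ℕ, GraphClass.StronglyUniformlyLimitQuasiWide U C s :=
    fun h => GraphClass.exists_stronglyUniformlyLimitQuasiWide h (h43 (h24 h))
  constructor
  · tfae_have 1 → 2 := h12
    tfae_have 2 → 4 := h24
    tfae_have 4 → 3 := h43
    tfae_have 3 → 1 := h31
    tfae_have 2 → 6 := h26
    tfae_have 6 → 5 := fun ⟨s, h⟩ => ⟨s, h.stronglyLimitQuasiWide⟩
    tfae_have 5 → 7 := fun ⟨_, h⟩ => h.limitQuasiWide
    tfae_have 6 → 8 := fun ⟨_, h⟩ => h.uniformlyLimitQuasiWide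
    tfae_have 8 → 10 := fun h => h.limitWinningForSplitter
    tfae_have 10 → 4 := fun h => h.limitTopNowhereDense
    tfae_have 7 → 4 := fun h => h.limitTopNowhereDense
    -- Uniform quasi-wideness of the finite graphs follows without heredity, so the finite game
    -- needs no extra hypothesis.
    tfae_have 6 → 9 := fun ⟨_, h⟩ => (h.uniformlyQuasiWide hU).winningForSplitter
    tfae_have 9 → 2 := fun h => h.topNowhereDense
    tfae_finish
  · intro hC
    tfae_have 1 → 3 := fun h => by
      obtain ⟨s, hs⟩ := h26 (h12 h)
      exact ⟨s, hs.uniformlyQuasiWide hU⟩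
    tfae_have 3 → 2 := fun ⟨s, h⟩ => ⟨s, h.quasiWide⟩
    tfae_have 2 → 1 := fun ⟨_, h⟩ => h31 (h43 (h24 (h.topNowhereDense hC)))
    tfae_finish
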